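/- A semilattice is a commutative idempotent semigroup $E$ with a zero element $0$; write $e\le f$ if $ef=e$, $e\lneq f$ if moreover $e\neq f$, and $E^\times=E\setminus\{0\}$. Let $\mathbb Z[E^\times]$ be the free $\mathbb Z$-module on $E^\times$ with the bilinear product for which the product of $e,f\in E^\times$ is $ef$ if $ef\ne0$ and $0$ otherwise; the element $0\in E$ is identified with $0\in\mathbb Z[E^\times]$, and $E(x)\subseteq E^\times$ denotes the support of $x\in\mathbb Z[E^\times]$. For a finite set $\mathcal R\subseteq E^\times$ put $\bigvee\mathcal R=\sum_{\varnothing\ne J\subseteq\mathcal R}(-1)^{|J|+1}\prod_{f\in J}f$, and for a subset $Y$ of a semilattice let $Y^\times$ be the set of its nonzero elements. A finite cover for $e\in E^\times$ is a finite set $\mathcal R\subseteq E^\times$ of elements $\le e$ such that every $f\in E^\times$ with $f\le e$ satisfies $fr\neq0$ for some $r\in\mathcal R$. Let $\Gamma$ be a group, let $E$ be a $\Gamma$-semilattice, i.e. a semilattice with a homomorphism $\tau$ from $\Gamma$ to the automorphism group of $E$, and for every $e\in E^\times$ let $\mathscr R(e)$ be a set of finite covers for $e$ such that: (i) for $d,e\in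 E^\times$ with $de\ne0$ and $\mathcal R\in\mathscr R(e)$, either $de\in(d\cdot\mathcal R)^\times$ or $(d\cdot\mathcal R)^\times\in\mathscr R(de)$; (ii) for $e\in E^\times$, pairwise distinct $\mathcal R_1,\dots,\mathcal R_r\in\mathscr R(e)$, $\varepsilon_i\in E(\bigvee\mathcal R_i)$ and $1\le j\le r$: if $\prod_{i\ne j}\varepsilon_i\ne0$, then $\prod_{i}\varepsilon_i\lneq\prod_{i\neq j}\varepsilon_i$ (where for $r=1$ the empty product means $e$); (iii) $\tau_g(\mathscr R(e))=\mathscr R(\tau_g(e))$ for all $g\in\Gamma$ and $e\in E^\times$. For $e\in E^\times$ and a non-empty finite $\mathscr S\subseteq\mathscr R(e)$ put $e(\mathscr S)=\prod_{\mathcal R\in\mathscr S}(e-\bigvee\mathcal R)\in\mathbb Z[E^\times]$. Let $$E(E,\mathscr R)=\{e(\mathscr S): e\in E^\times,\ \varnothing\ne\mathscr S\subseteq\mathscr R(e)\text{ finite}\}\cup\{0\}\subseteq\mathbb Z[E^\times],$$ and let $\mathscr R(E,\mathscr R)$ assign to $e(\mathscr S)$ the collection of the sets $\{e(\mathscr S\cup\{\tilde{\mathcal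 R}\})\}\cup\{f\cdot e(\mathscr S): f\in\tilde{\mathcal R},\ f\cdot e(\mathscr S)\neq0\}$ for $\tilde{\mathcal R}\in\mathscr R(e)\setminus\mathscr S$. Then $E(E,\mathscr R)$, with the product and the $\Gamma$-action of $\mathbb Z[E^\times]$, is again a $\Gamma$-semilattice, and $\mathscr R(E,\mathscr R)$ is a collection of finite covers for it satisfying (i)–(iii). So one can define iteratively $E_0=E$, $\mathscr R_0=\mathscr R$, $E_{k+1}=E(E_k,\mathscr R_k)$ and $\mathscr R_{k+1}=\mathscr R(E_k,\mathscr R_k)$. Theorem. Let $I$ be the $\mathbb Z$-span of $\{e-\bigvee\mathcal R: e\in E^\times,\ \mathcal R\in\mathscr R(e)\}$, which is a $\Gamma$-invariant ideal of $\mathbb Z[E^\times]$. Then the canonical projection $\mathbb Z[E^\times]\to\mathbb Z[E^\times]/I$ and the ring homomorphisms $\mathbb Z[E_{k+1}^\times]\to\mathbb Z[E_k^\times]$ induced by the inclusions $E_{k+1}\subseteq\mathbb Z[E_k^\times]$ form a $\Gamma$-equivariant long exact sequence $$\cdots\to\mathbb Z[E_2^\times]\to\mathbb Z[E_1^\times]\to\mathbb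 Z[E^\times]\to\mathbb Z[E^\times]/I\to0.$$ -/

import Mathlib

universe u v

namespace IndRes

/-! ### The integral semigroup ring of a semilattice with zero -/

/-- The integral semigroup ring `ℤ[Eˣ]` of a semilattice `E` with zero `⊥` (the semigroup operation
is `⊓`): the free `ℤ`-module on the set of nonzero elements of `E`. -/
def ZReg (E : Type u) [SemilatticeInf E] [OrderBot E] : Type u := {e : E // e ≠ ⊥} →₀ ℤ

section Ring

variable {E : Type u} [SemilatticeInf E] [OrderBot E]

namespace ZReg

noncomputable instance : AddCommGroup (ZReg E) :=
  inferInstanceAs (AddCommGroup ({e : E // e ≠ ⊥} →₀ ℤ))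

/-- The identification of `ℤ[Eˣ]` with the finitely supported functions `Eˣ → ℤ`. -/
noncomputable def toFinsupp : ZReg E ≃+ ({e : E // e ≠ ⊥} →₀ ℤ) := AddEquiv.refl _

open scoped Classical in
/-- The image in `ℤ[Eˣ]` of an element of `E`: a basis vector if `e ≠ 0`, and `0` if `e = 0`. -/
noncomputable def of (e : E) : ZReg E :=
  if h : e = ⊥ then 0 else toFinsupp.symm (Finsupp.single ⟨e, h⟩ 1)

/-- The support `E(x)` of `x ∈ ℤ[Eˣ]`: the nonzero elements of `E` at which the coefficient of `x`
is nonzero. -/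
noncomputable def supp (x : ZReg E) : Set E := {e | ∃ h : e ≠ ⊥, toFinsupp x ⟨e, h⟩ ≠ 0}

/-- The `ℤ`-linear extension to `ℤ[Eˣ]` of the restriction to `Eˣ` of a map `φ` on `E`. -/
noncomputable def linExt {B : Type*} [AddCommGroup B] (φ : E → B) : ZReg E →+ B :=
  (Finsupp.liftAddHom (fun e : {e : E // e ≠ ⊥} => zmultiplesHom B (φ e))).comp
    toFinsupp.toAddMonoidHom

/-- The product, bilinear with `e * f = ef` if `ef ≠ 0` and `e * f = 0` if `ef = 0`. -/
noncomputable instance : Mul (ZReg E) :=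
  ⟨fun x y => linExt (fun e => linExt (fun f => of (e ⊓ f))) x y⟩

theorem of_bot : of (⊥ : E) = 0 := by simp [of]

theorem of_of_ne {e : E} (h : e ≠ ⊥) : of e = toFinsupp.symm (Finsupp.single ⟨e, h⟩ 1) := by
  unfold of; rw [dif_neg h]

theorem linExt_of {B : Type*} [AddCommGroup B] (φ : E → B) (h0 : φ ⊥ = 0) (e : E) :
    linExt φ (of e) = φ e := by
  by_cases h : e = ⊥
  · subst h; rw [of_bot, map_zero, h0]
  · simp [linExt, of_of_ne h]

theorem induction {P : ZReg E → Prop} (hof : ∀ e, P (of e)) (hadd : ∀ x y, P x → P y → P (x + y))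
    (hneg : ∀ x, P x → P (-x)) (x : ZReg E) : P x := by
  have h0 : P 0 := by rw [← of_bot]; exact hof _
  have hz : ∀ (n : ℤ) (e : E), P (n • of e) := by
    intro n e
    induction n using Int.induction_on with
    | zero => simpa using h0
    | succ n ih => rw [add_smul, one_smul]; exact hadd _ _ ih (hof e)
    | pred n ih => rw [sub_smul, one_smul, sub_eq_add_neg]; exact hadd _ _ ih (hneg _ (hof e))
  have key : ∀ y : {e : E // e ≠ ⊥} →₀ ℤ, P (toFinsupp.symm y) := by
    intro y
    induction y using Finsupp.induction_linear with
    | zero => simpa using h0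
    | add f g hf hg => rw [map_add]; exact hadd _ _ hf hg
    | single e n =>
      have : Finsupp.single e n = n • Finsupp.single e (1 : ℤ) := by simp
      rw [this, map_zsmul, ← of_of_ne e.2]
      exact hz n e.1
  simpa using key (toFinsupp x)

theorem mul_def (x y : ZReg E) :
    x * y = linExt (fun e => linExt (fun f => of (e ⊓ f))) x y := rfl

theorem of_mul_of (e f : E) : of e * of f = of (e ⊓ f) := by
  have h : ∀ e : E, linExt (fun f => of (e ⊓ f)) (of f) = of (e ⊓ f) := fun e =>
    linExt_of _ (by simp [of_bot]) f
  rw [mul_def, linExt_of, h]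
  refine DFunLike.ext _ _ fun x => ?_
  induction x using induction with
  | hof e => rw [linExt_of _ (by simp [of_bot])]; simp [of_bot]
  | hadd x y hx hy => simp only [map_add, hx, hy]
  | hneg x hx => simp only [map_neg, hx]

theorem add_mul' (x y z : ZReg E) : (x + y) * z = x * z + y * z := by
  simp [mul_def]

theorem mul_add' (x y z : ZReg E) : x * (y + z) = x * y + x * z := by
  simp [mul_def]

theorem neg_mul' (x y : ZReg E) : (-x) * y = -(x * y) := by
  simp [mul_def]

theorem mul_neg' (x y : ZReg E) : x * (-y) = -(x * y) := by
  simp [mul_def]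

noncomputable instance : NonUnitalCommRing (ZReg E) :=
  { (inferInstance : AddCommGroup (ZReg E)), (inferInstance : Mul (ZReg E)) with
    left_distrib := mul_add'
    right_distrib := add_mul'
    zero_mul := fun x => by simp [mul_def]
    mul_zero := fun x => by simp [mul_def]
    mul_assoc := fun x y z => by
      induction x using induction with
      | hadd x y hx hy => simp only [add_mul', hx, hy]
      | hneg x hx => simp only [neg_mul', hx]
      | hof e =>
      induction y using induction with
      | hadd x y hx hy => simp only [mul_add', add_mul', hx, hy]
      | hneg x hx => simp only [neg_mul', mul_neg', hx]
      | hof f =>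
      induction z using induction with
      | hadd x y hx hy => simp only [mul_add', hx, hy]
      | hneg x hx => simp only [mul_neg', hx]
      | hof g => simp only [of_mul_of, inf_assoc]
    mul_comm := fun x y => by
      induction x using induction with
      | hadd x y hx hy => simp only [mul_add', add_mul', hx, hy]
      | hneg x hx => simp only [neg_mul', mul_neg', hx]
      | hof e =>
      induction y using induction with
      | hadd x y hx hy => simp only [mul_add', add_mul', hx, hy]
      | hneg x hx => simp only [neg_mul', mul_neg', hx]
      | hof f => simp only [of_mul_of, inf_comm] }

/-- The ring homomorphism `ℤ[Eˣ] → B` induced by a semigroup homomorphism `φ : E → B` into the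
multiplicative semigroup of a ring with `φ 0 = 0`. -/
noncomputable def lift {B : Type*} [NonUnitalCommRing B] (φ : E → B) (h0 : φ ⊥ = 0)
    (hmul : ∀ a b, φ (a ⊓ b) = φ a * φ b) : ZReg E →ₙ+* B :=
  { linExt φ with
    map_mul' := fun x y => by
      change linExt φ (x * y) = linExt φ x * linExt φ y
      induction x using induction with
      | hadd x y hx hy => simp only [map_add, add_mul, hx, hy]
      | hneg x hx => simp only [map_neg, neg_mul, hx]
      | hof e =>
      induction y using induction with
      | hadd x y hx hy => simp only [map_add, mul_add, hx, hy]
      | hneg x hx => simp only [map_neg, mul_neg, hx]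
      | hof f => rw [of_mul_of, linExt_of _ h0, linExt_of _ h0, linExt_of _ h0, hmul] }

theorem lift_of {B : Type*} [NonUnitalCommRing B] (φ : E → B) (h0 : φ ⊥ = 0)
    (hmul : ∀ a b, φ (a ⊓ b) = φ a * φ b) (e : E) : lift φ h0 hmul (of e) = φ e :=
  linExt_of φ h0 e

theorem hom_ext {B : Type*} [NonUnitalCommRing B] {f g : ZReg E →ₙ+* B}
    (h : ∀ e, f (of e) = g (of e)) (x : ZReg E) : f x = g x := by
  induction x using induction with
  | hof e => exact h e
  | hadd x y hx hy => simp only [map_add, hx, hy]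
  | hneg x hx => simp only [map_neg, hx]

/-- The ring homomorphism `ℤ[Eˣ] → ℤ[Fˣ]` induced by an isomorphism of semilattices. -/
noncomputable def map {F : Type*} [SemilatticeInf F] [OrderBot F] (φ : E ≃o F) :
    ZReg E →ₙ+* ZReg F :=
  lift (fun e => of (φ e)) (by simp [of_bot]) (fun a b => by rw [of_mul_of, map_inf])

theorem map_of {F : Type*} [SemilatticeInf F] [OrderBot F] (φ : E ≃o F) (e : E) :
    map φ (of e) = of (φ e) := lift_of _ _ _ e

/-- The action on `ℤ[Eˣ]` of automorphisms of the semilattice `E`. -/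
noncomputable def autMap : (E ≃o E) →* RingAut (ZReg E) where
  toFun φ :=
    { map φ with
      invFun := map φ.symm
      left_inv := fun x => hom_ext (f := (map φ.symm).comp (map φ)) (g := NonUnitalRingHom.id _)
        (fun e => by simp [map_of]) x
      right_inv := fun x => hom_ext (f := (map φ).comp (map φ.symm)) (g := NonUnitalRingHom.id _)
        (fun e => by simp [map_of]) x }
  map_one' := RingEquiv.ext fun x =>
    hom_ext (f := map (1 : E ≃o E)) (g := NonUnitalRingHom.id _) (fun e => by simp [map_of]) x
  map_mul' φ ψ := RingEquiv.ext fun x =>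
    hom_ext (f := map (φ * ψ)) (g := (map φ).comp (map ψ)) (fun e => by simp [map_of]) x

theorem autMap_of (φ : E ≃o E) (e : E) : autMap φ (of e) = of (φ e) := map_of φ e

/-- Evaluation at `p ∈ Eˣ`: the character of `ℤ[Eˣ]` with `e ↦ 1` if `p ≤ e`, else `e ↦ 0`. -/
noncomputable def ev (p : E) (hp : p ≠ ⊥) : ZReg E →ₙ+* ℤ := by
  classical
  exact lift (fun e => if p ≤ e then 1 else 0) (by simp [hp])
    (fun a b => by by_cases h1 : p ≤ a <;> by_cases h2 : p ≤ b <;> simp [h1, h2])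

open scoped Classical in
theorem ev_of (p : E) (hp : p ≠ ⊥) (e : E) : ev p hp (of e) = if p ≤ e then 1 else 0 :=
  lift_of _ _ _ e

theorem supp_finite (x : ZReg E) : (supp x).Finite := by
  refine ((toFinsupp x).support.finite_toSet.image Subtype.val).subset ?_
  rintro e ⟨h, he⟩
  exact ⟨⟨e, h⟩, by simpa using he, rfl⟩

theorem supp_nonempty {x : ZReg E} (hx : x ≠ 0) : (supp x).Nonempty := by
  by_contra h
  apply hx
  apply toFinsupp.injective
  ext ⟨e, he⟩
  by_contra hne
  exact h ⟨e, he, by simpa using hne⟩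

open scoped Classical in
theorem ev_eq_sum (p : E) (hp : p ≠ ⊥) (x : ZReg E) :
    ev p hp x = (toFinsupp x).sum (fun e n => if p ≤ e.1 then n else 0) := by
  change linExt (B := ℤ) (fun e : E => if p ≤ e then 1 else 0) x = _
  simp only [linExt, AddMonoidHom.comp_apply, Finsupp.liftAddHom_apply]
  refine Finset.sum_congr rfl fun e _ => ?_
  by_cases h : p ≤ e.1 <;> simp [h]

theorem exists_supp_of_ev_ne {p : E} {hp : p ≠ ⊥} {x : ZReg E} (h : ev p hp x ≠ 0) :
    ∃ e ∈ supp x, p ≤ e := by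
  classical
  rw [ev_eq_sum] at h
  obtain ⟨e, he, hne⟩ := Finset.exists_ne_zero_of_sum_ne_zero h
  refine ⟨e.1, ⟨e.2, by simpa using he⟩, ?_⟩
  by_contra hpe
  simp [hpe] at hne

theorem eq_zero_of_ev {x : ZReg E} (h : ∀ p hp, ev p hp x = 0) : x = 0 := by
  classical
  by_contra hx
  obtain ⟨p, hpm⟩ := (supp_finite x).exists_maximal (supp_nonempty hx)
  obtain ⟨hp, hc⟩ := hpm.1
  apply hc
  rw [← h p hp, ev_eq_sum, Finsupp.sum, Finset.sum_eq_single ⟨p, hp⟩]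
  · simp
  · intro e he hne
    rw [if_neg]
    intro hle
    have : e.1 ≤ p := hpm.2 ⟨e.2, by simpa using he⟩ hle
    exact hne (Subtype.ext (le_antisymm this hle))
  · intro h; simpa using h

theorem ext_ev {x y : ZReg E} (h : ∀ p hp, ev p hp x = ev p hp y) : x = y := by
  rw [← sub_eq_zero]
  exact eq_zero_of_ev fun p hp => by rw [map_sub, h p hp, sub_self]

open scoped Classical in
/-- The idempotent `⋁ R = ∑_{∅ ≠ J ⊆ R} (-1)^(|J| + 1) ∏_{f ∈ J} f` of `ℤ[Eˣ]`. -/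
noncomputable def join (R : Finset E) : ZReg E :=
  ∑ J ∈ R.powerset,
    if h : J.Nonempty then (-1 : ℤ) ^ (J.card + 1) • of (J.inf' h id) else 0

open scoped Classical in
theorem hom_join (χ : ZReg E →ₙ+* ℤ) (P : E → Prop) (hχ : ∀ e, χ (of e) = if P e then 1 else 0)
    (R : Finset E) : χ (join R) = if ∃ f ∈ R, P f then 1 else 0 := by
  have h1 : ∀ (J : Finset E) (h : J.Nonempty), χ (of (J.inf' h id)) = ∏ f ∈ J, χ (of f) := by
    intro J h
    induction h using Finset.Nonempty.cons_induction with
    | singleton a => simp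
    | cons a s ha hs ih =>
      rw [Finset.inf'_cons hs, Finset.prod_cons, ← ih, ← map_mul, of_mul_of]; rfl
  have h2 : χ (join R) = 1 - ∏ f ∈ R, (1 + -χ (of f)) := by
    rw [Finset.prod_one_add, join, map_sum, ← Finset.sum_erase_add (a := ∅) _ _ (by simp),
      ← Finset.sum_erase_add (a := ∅) R.powerset (fun t => ∏ i ∈ t, -χ (of i)) (by simp)]
    simp only [Finset.not_nonempty_empty, dite_false, map_zero, add_zero, Finset.prod_empty]
    rw [sub_add_cancel_right, ← Finset.sum_neg_distrib]
    refine Finset.sum_congr rfl fun J hJ => ?_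
    have hJ' : J.Nonempty := Finset.nonempty_iff_ne_empty.2 (Finset.ne_of_mem_erase hJ)
    rw [dif_pos hJ', map_zsmul, h1, Finset.prod_neg, smul_eq_mul]
    ring
  rw [h2]
  simp only [hχ]
  split_ifs with h
  · obtain ⟨f, hf, hPf⟩ := h
    rw [Finset.prod_eq_zero hf (by simp [hPf])]; simp
  · push Not at h
    rw [Finset.prod_congr rfl (fun f hf => by rw [if_neg (h f hf)])]; simp

open scoped Classical in
theorem ev_join (p : E) (hp : p ≠ ⊥) (R : Finset E) :
    ev p hp (join R) = if ∃ f ∈ R, p ≤ f then 1 else 0 :=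
  hom_join _ (fun e => p ≤ e) (ev_of p hp) R

theorem supp_zero : supp (0 : ZReg E) = ∅ := by
  ext e; simp [supp]

theorem supp_of {e : E} {a : E} (h : a ∈ supp (of e)) : a = e := by
  obtain ⟨ha, hc⟩ := h
  by_cases he : e = ⊥
  · subst he; simp [of_bot] at hc
  · rw [of_of_ne he] at hc
    by_contra hne
    apply hc
    simp [Ne.symm hne]

theorem supp_add {x y : ZReg E} {a : E} (h : a ∈ supp (x + y)) : a ∈ supp x ∨ a ∈ supp y := by
  obtain ⟨ha, hc⟩ := h
  by_contra! hn
  have h1 : toFinsupp x ⟨a, ha⟩ = 0 := by by_contra h; exact hn.1 ⟨ha, h⟩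
  have h2 : toFinsupp y ⟨a, ha⟩ = 0 := by by_contra h; exact hn.2 ⟨ha, h⟩
  apply hc
  simp [h1, h2]

theorem supp_zsmul {n : ℤ} {x : ZReg E} {a : E} (h : a ∈ supp (n • x)) : a ∈ supp x := by
  obtain ⟨ha, hc⟩ := h
  refine ⟨ha, fun h => hc ?_⟩
  simp [h]

theorem supp_sum {ι : Type*} {s : Finset ι} {f : ι → ZReg E} {a : E}
    (h : a ∈ supp (∑ i ∈ s, f i)) : ∃ i ∈ s, a ∈ supp (f i) := by
  classical
  induction s using Finset.induction_on with
  | empty => simp [supp_zero] at h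
  | insert i s hi ih =>
    rw [Finset.sum_insert hi] at h
    rcases supp_add h with h | h
    · exact ⟨i, by simp, h⟩
    · obtain ⟨j, hj, h⟩ := ih h
      exact ⟨j, by simp [hj], h⟩

theorem supp_join {R : Finset E} {a : E} (h : a ∈ supp (join R)) : ∃ f ∈ R, a ≤ f := by
  obtain ⟨J, hJ, h⟩ := supp_sum h
  split_ifs at h with hn
  · obtain ⟨f, hf⟩ := hn
    refine ⟨f, Finset.mem_powerset.1 hJ hf, ?_⟩
    rw [supp_of (supp_zsmul h)]
    exact Finset.inf'_le id hf
  · simp [supp_zero] at h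

theorem eq_sum (x : ZReg E) : x = ∑ e ∈ (toFinsupp x).support, toFinsupp x e • of e.1 := by
  apply toFinsupp.injective
  rw [map_sum]
  conv_lhs => rw [← Finsupp.sum_single (toFinsupp x)]
  refine Finset.sum_congr rfl fun e _ => ?_
  rw [map_zsmul, of_of_ne e.2]
  simp

theorem supp_lift {F : Type*} [SemilatticeInf F] [OrderBot F] (f : ZReg E →ₙ+* ZReg F) (ψ : E → F)
    (hf : ∀ e, f (of e) = of (ψ e)) {x : ZReg E} {a : F} (h : a ∈ supp (f x)) :
    ∃ e ∈ supp x, a = ψ e := by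
  rw [eq_sum x, map_sum] at h
  obtain ⟨e, he, h⟩ := supp_sum h
  rw [map_zsmul, hf] at h
  exact ⟨e.1, ⟨e.2, by simpa using he⟩, supp_of (supp_zsmul h)⟩

end ZReg

/-! ### Collections of finite covers -/

/-- `R` is a finite cover for `e`: a finite set of nonzero elements `≤ e` such that every nonzero
`f ≤ e` has a nonzero product with some element of `R`. -/
def IsFiniteCover (e : E) (R : Finset E) : Prop :=
  (∀ f ∈ R, f ≠ ⊥ ∧ f ≤ e) ∧ ∀ f : E, f ≠ ⊥ → f ≤ e → ∃ r ∈ R, f ⊓ r ≠ ⊥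

open scoped Classical in
/-- The set `(d · R)ˣ` of nonzero elements of the form `d f` with `f ∈ R`. -/
noncomputable def cut (d : E) (R : Finset E) : Finset E :=
  (R.image (fun f => d ⊓ f)).filter (fun f => f ≠ ⊥)

/-- The product of `e` and all the `ε i` with `i ∈ s`. When `ε i ≤ e` for all `i ∈ s`, this is the
product of the `ε i` over `s`, with the convention that the empty product is `e`. -/
def prodBelow {ι : Type*} (e : E) (s : Finset ι) (ε : ι → E) : E := s.fold (· ⊓ ·) e ε

/-- Condition (i), compatibility with products: if `de ≠ 0` and `R ∈ 𝓡(e)`, then `de ∈ (d · R)ˣ` or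
`(d · R)ˣ ∈ 𝓡(de)`. -/
def CondI (𝓡 : E → Set (Finset E)) : Prop :=
  ∀ d e : E, d ⊓ e ≠ ⊥ → ∀ R ∈ 𝓡 e, d ⊓ e ∈ cut d R ∨ cut d R ∈ 𝓡 (d ⊓ e)

open scoped Classical in
/-- Condition (ii), independence of the covers: for pairwise distinct covers in `𝓡(e)` (given as a
finite set `S`) and elements `ε R ∈ E(⋁ R)` for `R ∈ S`, leaving out one factor `ε Q` of the product
of all `ε R` makes the product strictly larger, provided that the product without `ε Q` is nonzero
(the product over the empty set is `e`). -/
def CondII (𝓡 : E → Set (Finset E)) : Prop :=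
  ∀ e : E, e ≠ ⊥ → ∀ S : Finset (Finset E), (∀ R ∈ S, R ∈ 𝓡 e) →
    ∀ ε : Finset E → E, (∀ R ∈ S, ε R ∈ (ZReg.join R).supp) →
      ∀ Q ∈ S, prodBelow e (S.erase Q) ε ≠ ⊥ → prodBelow e S ε < prodBelow e (S.erase Q) ε

/-- Condition (iii), invariance: `τ_g(𝓡(e)) = 𝓡(τ_g(e))`. -/
def CondIII {Γ : Type v} [Group Γ] (τ : Γ →* (E ≃o E)) (𝓡 : E → Set (Finset E)) : Prop :=
  ∀ (g : Γ) (e : E), e ≠ ⊥ →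
    (fun R : Finset E => R.map (τ g).toEquiv.toEmbedding) '' 𝓡 e = 𝓡 (τ g e)

/-- The element `e(S) = ∏_{R ∈ S} (e - ⋁ R)` of `ℤ[Eˣ]`, for a non-empty finite set `S` of finite
covers for `e`. (The product is started with `e`, which changes nothing since
`e (e - ⋁ R) = e - ⋁ R`, because `ℤ[Eˣ]` need not have a unit.) -/
noncomputable def eS (e : E) (S : Finset (Finset E)) : ZReg E :=
  S.fold (· * ·) (ZReg.of e) (fun R => ZReg.of e - ZReg.join R)

/-- The subset `E(E, 𝓡) = {e(S) | e ∈ Eˣ, ∅ ≠ S ⊆ 𝓡(e) finite} ∪ {0}` of `ℤ[Eˣ]`. -/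
def nextSet (𝓡 : E → Set (Finset E)) : Set (ZReg E) :=
  {x | ∃ (e : E) (S : Finset (Finset E)), e ≠ ⊥ ∧ S.Nonempty ∧ (∀ R ∈ S, R ∈ 𝓡 e) ∧ x = eS e S}
    ∪ {0}

open scoped Classical in
/-- The subset `R(S, Q) = {e(S ∪ {Q})} ∪ {f e(S) | f ∈ Q, f e(S) ≠ 0}` of `ℤ[Eˣ]`. -/
def nextCover (e : E) (S : Finset (Finset E)) (Q : Finset E) : Set (ZReg E) :=
  {eS e (insert Q S)} ∪ {x | ∃ f ∈ Q, x = ZReg.of f * eS e S ∧ x ≠ 0}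

/-! ### Pointwise description of the elements of the new semilattice -/

open ZReg

set_option linter.unusedSectionVars false

theorem mem_cut {d : E} {R : Finset E} {a : E} :
    a ∈ cut d R ↔ ∃ f ∈ R, d ⊓ f = a ∧ a ≠ ⊥ := by
  simp only [cut, Finset.mem_filter, Finset.mem_image]
  constructor
  · rintro ⟨⟨f, hf, h⟩, ha⟩; exact ⟨f, hf, h, ha⟩
  · rintro ⟨f, hf, h, ha⟩; exact ⟨⟨f, hf, h⟩, ha⟩

theorem le_prodBelow {ι : Type*} {e : E} {s : Finset ι} {ε : ι → E} {p : E} :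
    p ≤ prodBelow e s ε ↔ p ≤ e ∧ ∀ i ∈ s, p ≤ ε i := by
  classical
  unfold prodBelow
  induction s using Finset.induction_on with
  | empty => simp
  | insert i s hi ih =>
    rw [Finset.fold_insert hi, le_inf_iff, ih]
    simp only [Finset.mem_insert, forall_eq_or_imp]
    tauto

/-- `p` belongs to the subset of `Eˣ` described by `e(S)`. -/
def Below (e : E) (S : Finset (Finset E)) (p : E) : Prop :=
  p ≤ e ∧ ∀ R ∈ S, ∀ f ∈ R, ¬ p ≤ f

open scoped Classical in
theorem ev_eS {e : E} {S : Finset (Finset E)} (hS : ∀ R ∈ S, ∀ f ∈ R, f ≤ e) (p : E) (hp : p ≠ ⊥) :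
    ev p hp (eS e S) = if Below e S p then 1 else 0 := by
  unfold eS Below
  induction S using Finset.induction_on with
  | empty => simp [ev_of]
  | insert R S hR ih =>
    rw [Finset.fold_insert hR, map_mul, ih (fun R hR => hS R (by simp [hR])), map_sub, ev_of,
      ev_join]
    simp only [Finset.mem_insert, forall_eq_or_imp]
    by_cases h1 : p ≤ e
    · by_cases h2 : ∃ f ∈ R, p ≤ f
      · have h3 : ¬ ∀ f ∈ R, ¬ p ≤ f := by push Not; exact h2
        simp [h1, h2, h3]
      · have h3 : ∀ f ∈ R, ¬ p ≤ f := by push Not at h2; exact h2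
        simp only [h1, if_true, h2, if_false, sub_zero, one_mul, true_and]
        exact if_congr (by tauto) rfl rfl
    · have h2 : ¬ ∃ f ∈ R, p ≤ f := by
        rintro ⟨f, hf, hpf⟩
        exact h1 (hpf.trans (hS R (by simp) f hf))
      simp [h1, h2]

theorem ev_mul_ite {p : E} {hp : p ≠ ⊥} {x y : ZReg E} {P Q : Prop} [Decidable P] [Decidable Q]
    [Decidable (P ∧ Q)]
    (hx : ev p hp x = if P then 1 else 0) (hy : ev p hp y = if Q then 1 else 0) :
    ev p hp (x * y) = if P ∧ Q then 1 else 0 := by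
  rw [map_mul, hx, hy]
  by_cases hP : P <;> by_cases hQ : Q <;> simp [hP, hQ]

section Step

variable {𝓡 : E → Set (Finset E)}

theorem le_of_mem (hc : ∀ e : E, e ≠ ⊥ → ∀ R ∈ 𝓡 e, IsFiniteCover e R)
    {e : E} (he : e ≠ ⊥) {S : Finset (Finset E)} (hS : ∀ R ∈ S, R ∈ 𝓡 e) :
    ∀ R ∈ S, ∀ f ∈ R, f ≤ e := fun R hR f hf => ((hc e he R (hS R hR)).1 f hf).2

theorem exists_supp (hc : ∀ e : E, e ≠ ⊥ → ∀ R ∈ 𝓡 e, IsFiniteCover e R)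
    {e : E} (he : e ≠ ⊥) {R : Finset E} (hR : R ∈ 𝓡 e) {f : E} (hf : f ∈ R) :
    ∃ δ ∈ supp (join R), f ≤ δ := by
  have hf0 := ((hc e he R hR).1 f hf).1
  refine exists_supp_of_ev_ne (p := f) (hp := hf0) ?_
  rw [ev_join, if_pos ⟨f, hf, le_rfl⟩]
  exact one_ne_zero

theorem not_le_of_prod (hc : ∀ e : E, e ≠ ⊥ → ∀ R ∈ 𝓡 e, IsFiniteCover e R)
    (hii : CondII 𝓡) {e : E} (he : e ≠ ⊥) {S : Finset (Finset E)} (hS : ∀ R ∈ S, R ∈ 𝓡 e)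
    {ε : Finset E → E} (hε : ∀ R ∈ S, ε R ∈ supp (join R)) (hp : prodBelow e S ε ≠ ⊥)
    {Q : Finset E} (hQ : Q ∈ 𝓡 e) (hQS : Q ∉ S) {f : E} (hf : f ∈ Q) : ¬ prodBelow e S ε ≤ f := by
  classical
  intro hle
  obtain ⟨δ, hδ, hfδ⟩ := exists_supp hc he hQ hf
  have hne : ∀ R ∈ S, R ≠ Q := fun R hR h => hQS (h ▸ hR)
  have heq : prodBelow e S (Function.update ε Q δ) = prodBelow e S ε := by
    refine eq_of_forall_le_iff fun p => ?_
    rw [le_prodBelow, le_prodBelow]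
    refine and_congr_right fun _ => forall₂_congr fun R hR => ?_
    rw [Function.update_of_ne (hne R hR)]
  have h := hii e he (insert Q S) (by simpa [hQ] using hS) (Function.update ε Q δ) (by
      intro R hR
      rcases Finset.mem_insert.1 hR with rfl | hR
      · simpa using hδ
      · rw [Function.update_of_ne (hne R hR)]; exact hε R hR) Q (by simp) (by
      rw [Finset.erase_insert hQS, heq]; exact hp)
  rw [Finset.erase_insert hQS, heq] at h
  apply h.not_ge
  have hle' := (le_prodBelow (p := prodBelow e S ε) (e := e) (s := S) (ε := ε)).1 le_rfl
  rw [le_prodBelow]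
  refine ⟨hle'.1, ?_⟩
  intro R hR
  rcases Finset.mem_insert.1 hR with rfl | hR
  · simpa using hle.trans hfδ
  · rw [Function.update_of_ne (hne R hR)]; exact hle'.2 R hR

theorem below_prod (hc : ∀ e : E, e ≠ ⊥ → ∀ R ∈ 𝓡 e, IsFiniteCover e R)
    (hii : CondII 𝓡) {e : E} (he : e ≠ ⊥) {S : Finset (Finset E)} (hS : ∀ R ∈ S, R ∈ 𝓡 e)
    {ε : Finset E → E} (hε : ∀ R ∈ S, ε R ∈ supp (join R)) (hp : prodBelow e S ε ≠ ⊥)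
    {T : Finset (Finset E)} (hT : ∀ R ∈ T, R ∈ 𝓡 e) (hd : ∀ R ∈ T, R ∉ S) :
    Below e T (prodBelow e S ε) :=
  ⟨(le_prodBelow.1 le_rfl).1, fun R hR _ hf =>
    not_le_of_prod hc hii he hS hε hp (hT R hR) (hd R hR) hf⟩

theorem below_self (hc : ∀ e : E, e ≠ ⊥ → ∀ R ∈ 𝓡 e, IsFiniteCover e R)
    (hii : CondII 𝓡) {e : E} (he : e ≠ ⊥) {T : Finset (Finset E)} (hT : ∀ R ∈ T, R ∈ 𝓡 e) :
    Below e T e :=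
  below_prod hc hii he (S := ∅) (by simp) (ε := fun _ => e) (by simp) (by simpa [prodBelow] using he)
    hT (by simp)

theorem eS_ne_zero (hc : ∀ e : E, e ≠ ⊥ → ∀ R ∈ 𝓡 e, IsFiniteCover e R)
    (hii : CondII 𝓡) {e : E} (he : e ≠ ⊥) {T : Finset (Finset E)} (hT : ∀ R ∈ T, R ∈ 𝓡 e) :
    eS e T ≠ 0 := by
  intro h
  have := ev_eS (le_of_mem hc he hT) e he
  rw [h, map_zero, if_pos (below_self hc hii he hT)] at this
  exact zero_ne_one this

theorem eS_inj (hc : ∀ e : E, e ≠ ⊥ → ∀ R ∈ 𝓡 e, IsFiniteCover e R)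
    (hii : CondII 𝓡) {e e' : E} (he : e ≠ ⊥) (he' : e' ≠ ⊥) {S S' : Finset (Finset E)}
    (hS : ∀ R ∈ S, R ∈ 𝓡 e) (hS' : ∀ R ∈ S', R ∈ 𝓡 e') (h : eS e S = eS e' S') :
    e = e' ∧ S = S' := by
  classical
  have key : ∀ p, p ≠ ⊥ → (Below e S p ↔ Below e' S' p) := by
    intro p hp
    have h1 := ev_eS (le_of_mem hc he hS) p hp
    rw [h, ev_eS (le_of_mem hc he' hS')] at h1
    by_cases a : Below e S p <;> by_cases b : Below e' S' p <;> simp_all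
  have hee : e = e' := le_antisymm ((key e he).1 (below_self hc hii he hS)).1
    ((key e' he').2 (below_self hc hii he' hS')).1
  subst hee
  have sub : ∀ {S S' : Finset (Finset E)}, (∀ R ∈ S, R ∈ 𝓡 e) → (∀ R ∈ S', R ∈ 𝓡 e) →
      (∀ p, p ≠ ⊥ → (Below e S p ↔ Below e S' p)) → S' ⊆ S := by
    intro S S' hS hS' key R hR
    by_contra hRS
    obtain ⟨f, hf, hef⟩ := (hc e he R (hS' R hR)).2 e he le_rfl
    obtain ⟨δ, hδ, hfδ⟩ := exists_supp hc he (hS' R hR) hf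
    have hp : prodBelow e {R} (fun _ => δ) ≠ ⊥ := by
      refine ne_bot_of_le_ne_bot hef (le_prodBelow.2 ⟨inf_le_left, fun _ _ => ?_⟩)
      exact inf_le_right.trans hfδ
    have hb := below_prod hc hii he (S := {R}) (by simpa using hS' R hR) (ε := fun _ => δ)
      (by simpa using hδ) hp hS (fun R' hR' h => hRS (Finset.mem_singleton.1 h ▸ hR'))
    obtain ⟨f', hf', hδf⟩ := supp_join hδ
    exact ((key _ hp).1 hb).2 R hR f' hf' (((le_prodBelow.1 le_rfl).2 R (by simp)).trans hδf)
  exact ⟨rfl, (sub hS' hS fun p hp => (key p hp).symm).antisymm (sub hS hS' key)⟩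

theorem below_cut {d e : E} {S S' : Finset (Finset E)} (hS' : ∀ R', R' ∈ S' ↔ ∃ R ∈ S, cut d R = R')
    {p : E} (hp : p ≠ ⊥) : Below (d ⊓ e) S' p ↔ p ≤ d ∧ Below e S p := by
  constructor
  · rintro ⟨hpe, h⟩
    have hpd := hpe.trans inf_le_left
    refine ⟨hpd, hpe.trans inf_le_right, fun R hR f hf hpf => ?_⟩
    refine h (cut d R) ((hS' _).2 ⟨R, hR, rfl⟩) (d ⊓ f) (mem_cut.2 ⟨f, hf, rfl, ?_⟩)
      (le_inf hpd hpf)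
    exact ne_bot_of_le_ne_bot hp (le_inf hpd hpf)
  · rintro ⟨hpd, hpe, h⟩
    refine ⟨le_inf hpd hpe, fun R' hR' f' hf' hpf' => ?_⟩
    obtain ⟨R, hR, rfl⟩ := (hS' _).1 hR'
    obtain ⟨f, hf, rfl, -⟩ := mem_cut.1 hf'
    exact h R hR f hf (hpf'.trans inf_le_right)

theorem of_mul_eS (hc : ∀ e : E, e ≠ ⊥ → ∀ R ∈ 𝓡 e, IsFiniteCover e R)
    (hi : CondI 𝓡) {d e : E} (hde : d ⊓ e ≠ ⊥) {S : Finset (Finset E)} (hS : ∀ R ∈ S, R ∈ 𝓡 e) :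
    of d * eS e S = 0 ∨ ∃ S' : Finset (Finset E), (∀ R', R' ∈ S' ↔ ∃ R ∈ S, cut d R = R') ∧
      (∀ R' ∈ S', R' ∈ 𝓡 (d ⊓ e)) ∧ of d * eS e S = eS (d ⊓ e) S' := by
  classical
  have he : e ≠ ⊥ := ne_bot_of_le_ne_bot hde inf_le_right
  by_cases h : ∃ R ∈ S, d ⊓ e ∈ cut d R
  · left
    obtain ⟨R, hR, hm⟩ := h
    obtain ⟨f, hf, hdf, -⟩ := mem_cut.1 hm
    refine eq_zero_of_ev fun p hp => ?_
    rw [ev_mul_ite (ev_of p hp d) (ev_eS (le_of_mem hc he hS) p hp), if_neg]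
    rintro ⟨hpd, hpe, h⟩
    refine h R hR f hf ?_
    have : p ≤ d ⊓ f := hdf ▸ le_inf hpd hpe
    exact this.trans inf_le_right
  · right
    push Not at h
    have hS' : ∀ R', R' ∈ S.image (cut d) ↔ ∃ R ∈ S, cut d R = R' := fun R' => Finset.mem_image
    have hS'' : ∀ R' ∈ S.image (cut d), R' ∈ 𝓡 (d ⊓ e) := by
      intro R' hR'
      obtain ⟨R, hR, rfl⟩ := (hS' _).1 hR'
      exact (hi d e hde R (hS R hR)).resolve_left (h R hR)
    refine ⟨S.image (cut d), hS', hS'', ext_ev fun p hp => ?_⟩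
    rw [ev_mul_ite (ev_of p hp d) (ev_eS (le_of_mem hc he hS) p hp),
      ev_eS (le_of_mem hc hde hS'') p hp]
    simp only [below_cut hS' hp]

theorem of_mul_eS_mem (hc : ∀ e : E, e ≠ ⊥ → ∀ R ∈ 𝓡 e, IsFiniteCover e R)
    (hi : CondI 𝓡) {d e : E} (he : e ≠ ⊥) {S : Finset (Finset E)} (hSn : S.Nonempty)
    (hS : ∀ R ∈ S, R ∈ 𝓡 e) : of d * eS e S ∈ nextSet 𝓡 := by
  by_cases hde : d ⊓ e = ⊥
  · right
    have : ∀ T : Finset (Finset E), (∀ R ∈ T, ∀ f ∈ R, f ≤ e) → of d * eS e T = 0 := by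
      intro T hT
      refine eq_zero_of_ev fun p hp => ?_
      classical
      rw [ev_mul_ite (ev_of p hp d) (ev_eS hT p hp), if_neg]
      rintro ⟨hpd, hpe, -⟩
      exact hp (le_bot_iff.1 (hde ▸ le_inf hpd hpe))
    exact this S (le_of_mem hc he hS)
  · rcases of_mul_eS hc hi hde hS with h | ⟨S', hS', hm, h⟩
    · right; exact h
    · left
      obtain ⟨R, hR⟩ := hSn
      exact ⟨d ⊓ e, S', hde, ⟨cut d R, (hS' _).2 ⟨R, hR, rfl⟩⟩, hm, h⟩

theorem eS_mul_eS (hc : ∀ e : E, e ≠ ⊥ → ∀ R ∈ 𝓡 e, IsFiniteCover e R)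
    (hi : CondI 𝓡) {d e : E} {S T : Finset (Finset E)} (hd : d ≠ ⊥) (he : e ≠ ⊥)
    (hS : ∀ R ∈ S, R ∈ 𝓡 d) (hT : ∀ R ∈ T, R ∈ 𝓡 e) (hne : eS d S * eS e T ≠ 0) :
    ∃ (_ : d ⊓ e ≠ ⊥) (W : Finset (Finset E)),
      (∀ R', R' ∈ W ↔ (∃ R ∈ S, cut e R = R') ∨ (∃ R ∈ T, cut d R = R')) ∧
      (∀ R' ∈ W, R' ∈ 𝓡 (d ⊓ e)) ∧ eS d S * eS e T = eS (d ⊓ e) W := by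
  classical
  have hSl := le_of_mem hc hd hS
  have hTl := le_of_mem hc he hT
  have hde : d ⊓ e ≠ ⊥ := by
    intro hde
    refine hne (eq_zero_of_ev fun p hp => ?_)
    rw [ev_mul_ite (ev_eS hSl p hp) (ev_eS hTl p hp), if_neg]
    rintro ⟨⟨hpd, -⟩, hpe, -⟩
    exact hp (le_bot_iff.1 (hde ▸ le_inf hpd hpe))
  have hed : e ⊓ d ≠ ⊥ := by rwa [inf_comm]
  have h1 : eS d S * eS e T = (of e * eS d S) * (of d * eS e T) := by
    refine ext_ev fun p hp => ?_
    rw [ev_mul_ite (ev_eS hSl p hp) (ev_eS hTl p hp),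
      ev_mul_ite (ev_mul_ite (ev_of p hp e) (ev_eS hSl p hp))
        (ev_mul_ite (ev_of p hp d) (ev_eS hTl p hp))]
    refine if_congr ?_ rfl rfl
    unfold Below
    tauto
  rcases of_mul_eS hc hi hed hS with h | ⟨S', hS', hSm, hSe⟩
  · exact absurd (by rw [h1, h, zero_mul]) hne
  rcases of_mul_eS hc hi hde hT with h | ⟨T', hT', hTm, hTe⟩
  · exact absurd (by rw [h1, h, mul_zero]) hne
  rw [inf_comm] at hSm hSe
  have hW : ∀ R' ∈ S' ∪ T', R' ∈ 𝓡 (d ⊓ e) := by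
    intro R' hR'
    rcases Finset.mem_union.1 hR' with h | h
    · exact hSm R' h
    · exact hTm R' h
  refine ⟨hde, S' ∪ T', fun R' => ?_, hW, ?_⟩
  · rw [Finset.mem_union, hS', hT']
  · rw [h1, hSe, hTe]
    refine ext_ev fun p hp => ?_
    rw [ev_mul_ite (ev_eS (le_of_mem hc hde hSm) p hp) (ev_eS (le_of_mem hc hde hTm) p hp),
      ev_eS (le_of_mem hc hde hW)]
    refine if_congr ?_ rfl rfl
    unfold Below
    simp only [Finset.mem_union]
    constructor
    · rintro ⟨⟨a, b⟩, -, c⟩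
      exact ⟨a, fun R hR => hR.elim (b R) (c R)⟩
    · rintro ⟨a, b⟩
      exact ⟨⟨a, fun R hR => b R (Or.inl hR)⟩, a, fun R hR => b R (Or.inr hR)⟩

theorem mul_mem_nextSet (hc : ∀ e : E, e ≠ ⊥ → ∀ R ∈ 𝓡 e, IsFiniteCover e R)
    (hi : CondI 𝓡) {x y : ZReg E} (hx : x ∈ nextSet 𝓡) (hy : y ∈ nextSet 𝓡) :
    x * y ∈ nextSet 𝓡 := by
  by_cases hne : x * y = 0
  · right; exact hne
  rcases hx with ⟨d, S, hd, hSn, hS, rfl⟩ | hx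
  · rcases hy with ⟨e, T, he, hTn, hT, rfl⟩ | hy
    · obtain ⟨hde, W, hW, hWm, h⟩ := eS_mul_eS hc hi hd he hS hT hne
      left
      obtain ⟨R, hR⟩ := hSn
      exact ⟨d ⊓ e, W, hde, ⟨_, (hW _).2 (Or.inl ⟨R, hR, rfl⟩)⟩, hWm, h⟩
    · rw [Set.mem_singleton_iff.1 hy, mul_zero] at hne; exact absurd rfl hne
  · rw [Set.mem_singleton_iff.1 hx, zero_mul] at hne; exact absurd rfl hne

open scoped Classical in
theorem exists_ev_of_mem (hc : ∀ e : E, e ≠ ⊥ → ∀ R ∈ 𝓡 e, IsFiniteCover e R)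
    {x : ZReg E} (hx : x ∈ nextSet 𝓡) :
    ∃ P : E → Prop, ∀ p hp, ev p hp x = if P p then 1 else 0 := by
  rcases hx with ⟨e, S, he, -, hS, rfl⟩ | hx
  · exact ⟨Below e S, ev_eS (le_of_mem hc he hS)⟩
  · exact ⟨fun _ => False, fun p hp => by rw [Set.mem_singleton_iff.1 hx]; simp⟩

theorem mul_self_of_mem (hc : ∀ e : E, e ≠ ⊥ → ∀ R ∈ 𝓡 e, IsFiniteCover e R)
    {x : ZReg E} (hx : x ∈ nextSet 𝓡) : x * x = x := by
  classical
  obtain ⟨P, hP⟩ := exists_ev_of_mem hc hx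
  refine ext_ev fun p hp => ?_
  rw [ev_mul_ite (hP p hp) (hP p hp), hP p hp]
  exact if_congr (and_self_iff) rfl rfl

end Step
end Ring

/-! ### Γ-semilattices with finite covers and the construction of the next one -/

/-- A `Γ`-semilattice `E` together with a collection `cov` of finite covers for `E` that satisfies
the conditions (i), (ii) and (iii). The values `cov e` only matter for `e ≠ 0`. -/
structure CoverSystem (Γ : Type v) [Group Γ] where
  /-- The underlying set of the semilattice. -/
  E : Type u
  /-- The product of the semilattice is `⊓`. -/
  [semilatticeInf : SemilatticeInf E]
  /-- The zero element of the semilattice is `⊥`. -/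
  [orderBot : OrderBot E]
  /-- The action of `Γ` by automorphisms. -/
  τ : Γ →* (E ≃o E)
  /-- The set of finite covers attached to each element. -/
  cov : E → Set (Finset E)
  isFiniteCover : ∀ e : E, e ≠ ⊥ → ∀ R ∈ cov e, IsFiniteCover e R
  condI : CondI cov
  condII : CondII cov
  condIII : CondIII τ cov

namespace CoverSystem

open ZReg

variable {Γ : Type v} [Group Γ] (X : CoverSystem.{u, v} Γ)

instance : SemilatticeInf X.E := X.semilatticeInf
instance : OrderBot X.E := X.orderBot

/-- The underlying set `E(E, 𝓡) ⊆ ℤ[Eˣ]` of the next semilattice. -/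
@[ext]
structure Next : Type u where
  /-- The element of `ℤ[Eˣ]`. -/
  val : ZReg X.E
  mem : val ∈ nextSet X.cov

/-- The product of `E(E, 𝓡)` is that of `ℤ[Eˣ]`. -/
noncomputable instance : Min X.Next :=
  ⟨fun x y => ⟨x.1 * y.1, mul_mem_nextSet X.isFiniteCover X.condI x.2 y.2⟩⟩

/-- `E(E, 𝓡)` as a semilattice. -/
noncomputable instance : SemilatticeInf X.Next :=
  SemilatticeInf.mk' (fun a b => Next.ext (mul_comm a.1 b.1))
    (fun a b c => Next.ext (mul_assoc a.1 b.1 c.1))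
    (fun a => Next.ext (mul_self_of_mem X.isFiniteCover a.2))

/-- The zero element of `E(E, 𝓡)` is that of `ℤ[Eˣ]`. -/
noncomputable instance : OrderBot X.Next where
  bot := ⟨0, Or.inr rfl⟩
  bot_le a := Next.ext (mul_zero a.1)

variable {X}

theorem val_inf (a b : X.Next) : (a ⊓ b).1 = a.1 * b.1 := rfl

theorem val_bot : (⊥ : X.Next).1 = 0 := rfl

theorem ne_bot_iff {a : X.Next} : a ≠ ⊥ ↔ a.1 ≠ 0 := by
  rw [Ne, Next.ext_iff, val_bot]

theorem next_le_iff {a b : X.Next} : a ≤ b ↔ a.1 * b.1 = a.1 := by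
  rw [← inf_eq_left, Next.ext_iff, val_inf]

theorem exists_rep {a : X.Next} (ha : a ≠ ⊥) : ∃ (e : X.E) (S : Finset (Finset X.E)),
    e ≠ ⊥ ∧ S.Nonempty ∧ (∀ R ∈ S, R ∈ X.cov e) ∧ a.1 = eS e S :=
  a.2.resolve_right (ne_bot_iff.1 ha)

variable (X)

/-- The collection `𝓡(E, 𝓡)` of finite covers for `E(E, 𝓡)`: for `e ∈ Eˣ` and `∅ ≠ S ⊆ 𝓡(e)` finite,
the covers attached to `e(S)` are the sets `R(S, Q)` with `Q ∈ 𝓡(e) \ S`. -/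
def nextCov (x : X.Next) : Set (Finset X.Next) :=
  {T | ∃ (e : X.E) (S : Finset (Finset X.E)) (Q : Finset X.E), e ≠ ⊥ ∧ S.Nonempty ∧
    (∀ R ∈ S, R ∈ X.cov e) ∧ Q ∈ X.cov e ∧ Q ∉ S ∧ x.1 = eS e S ∧
    Next.val '' (T : Set X.Next) = nextCover e S Q}

variable {X}

theorem ev_next (a : X.Next) (p : X.E) (hp : p ≠ ⊥) : ev p hp a.1 = 0 ∨ ev p hp a.1 = 1 := by
  obtain ⟨P, hP⟩ := exists_ev_of_mem X.isFiniteCover a.2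
  rw [hP]; split_ifs <;> simp

theorem exists_ev_of_ne {a : X.Next} (ha : a ≠ ⊥) : ∃ p hp, ev p hp a.1 = 1 := by
  by_contra! h
  exact ne_bot_iff.1 ha (eq_zero_of_ev fun p hp => (ev_next a p hp).resolve_right (h p hp))

theorem le_iff_ev {a b : X.Next} : a ≤ b ↔ ∀ p hp, ev p hp a.1 = 1 → ev p hp b.1 = 1 := by
  rw [next_le_iff]
  constructor
  · intro h p hp ha
    rw [← h, map_mul] at ha
    rcases ev_next b p hp with hb | hb
    · rw [hb, mul_zero] at ha; exact absurd ha zero_ne_one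
    · exact hb
  · intro h
    refine ext_ev fun p hp => ?_
    rw [map_mul]
    rcases ev_next a p hp with ha | ha
    · rw [ha, zero_mul]
    · rw [h p hp ha, mul_one]

theorem ev_eS_iff {e : X.E} (he : e ≠ ⊥) {S : Finset (Finset X.E)} (hS : ∀ R ∈ S, R ∈ X.cov e)
    {p : X.E} (hp : p ≠ ⊥) : ev p hp (eS e S) = 1 ↔ Below e S p := by
  classical
  rw [ev_eS (le_of_mem X.isFiniteCover he hS)]
  split_ifs with h <;> simp [h]

theorem ev_of_mul_iff {e f : X.E} (he : e ≠ ⊥) {S : Finset (Finset X.E)}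
    (hS : ∀ R ∈ S, R ∈ X.cov e)
    {p : X.E} (hp : p ≠ ⊥) : ev p hp (of f * eS e S) = 1 ↔ p ≤ f ∧ Below e S p := by
  classical
  rw [ev_mul_ite (ev_of p hp f) (ev_eS (le_of_mem X.isFiniteCover he hS) p hp)]
  split_ifs with h <;> simp [h]

theorem below_insert [DecidableEq (Finset X.E)] {e : X.E} {S : Finset (Finset X.E)} {Q : Finset X.E}
    {p : X.E} : Below e (insert Q S) p ↔ Below e S p ∧ ∀ f ∈ Q, ¬ p ≤ f := by
  unfold Below
  simp only [Finset.mem_insert, forall_eq_or_imp]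
  tauto

theorem mem_insert_cov [DecidableEq (Finset X.E)] {e : X.E} {S : Finset (Finset X.E)}
    {Q : Finset X.E} (hS : ∀ R ∈ S, R ∈ X.cov e) (hQ : Q ∈ X.cov e) :
    ∀ R ∈ insert Q S, R ∈ X.cov e := by
  intro R hR
  rcases Finset.mem_insert.1 hR with rfl | hR
  · exact hQ
  · exact hS R hR

theorem mem_cover_iff {T : Finset X.Next} {e : X.E} {S : Finset (Finset X.E)} {Q : Finset X.E}
    (h : Next.val '' (T : Set X.Next) = nextCover e S Q) (t : X.Next) :
    t ∈ T ↔ t.1 ∈ nextCover e S Q := by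
  rw [← h]
  exact ⟨fun ht => ⟨t, ht, rfl⟩, fun ⟨s, hs, hst⟩ => Next.ext hst ▸ hs⟩

theorem next_isFiniteCover (x : X.Next) (_hx : x ≠ ⊥) (T : Finset X.Next) (hT : T ∈ X.nextCov x) :
    IsFiniteCover x T := by
  classical
  obtain ⟨e, S, Q, he, hSn, hS, hQ, hQS, hxe, hTe⟩ := hT
  have hQS' := mem_insert_cov hS hQ
  have hmem := mem_cover_iff hTe
  refine ⟨fun t ht => ?_, fun y hy hyx => ?_⟩
  · rcases (hmem t).1 ht with h | ⟨f, hf, h, h0⟩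
    · have h : t.1 = eS e (insert Q S) := by convert! Set.mem_singleton_iff.1 h
      refine ⟨ne_bot_iff.2 (h ▸ eS_ne_zero X.isFiniteCover X.condII he hQS'), ?_⟩
      rw [le_iff_ev, h, hxe]
      intro p hp
      rw [ev_eS_iff he hQS', ev_eS_iff he hS, below_insert]
      exact And.left
    · refine ⟨ne_bot_iff.2 h0, ?_⟩
      rw [le_iff_ev, h, hxe]
      intro p hp
      rw [ev_of_mul_iff he hS, ev_eS_iff he hS]
      exact And.right
  · obtain ⟨p, hp, hpy⟩ := exists_ev_of_ne hy
    have hpx := le_iff_ev.1 hyx p hp hpy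
    rw [hxe, ev_eS_iff he hS] at hpx
    have key : ∀ z ∈ nextCover e S Q, ev p hp z = 1 → ∃ r ∈ T, y ⊓ r ≠ ⊥ := by
      intro z hz hev
      rw [← hTe] at hz
      obtain ⟨t, ht, rfl⟩ := hz
      refine ⟨t, ht, ne_bot_iff.2 fun h => ?_⟩
      have := congrArg (ev p hp) h
      rw [val_inf, map_mul, hpy, hev, map_zero] at this
      exact one_ne_zero this
    by_cases h : ∃ f ∈ Q, p ≤ f
    · obtain ⟨f, hf, hpf⟩ := h
      have h1 : ev p hp (of f * eS e S) = 1 := (ev_of_mul_iff he hS hp).2 ⟨hpf, hpx⟩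
      refine key _ (Or.inr ⟨f, hf, rfl, fun h => ?_⟩) h1
      rw [h, map_zero] at h1; exact zero_ne_one h1
    · push Not at h
      refine key (eS e (insert Q S)) (Or.inl ?_) ((ev_eS_iff he hQS' hp).2 (below_insert.2 ⟨hpx, h⟩))
      rw [Set.mem_singleton_iff]

theorem next_condI : CondI X.nextCov := by
  classical
  intro x y hxy T hT
  have hx : x ≠ ⊥ := ne_bot_of_le_ne_bot hxy inf_le_left
  obtain ⟨e, S, Q, he, hSn, hS, hQ, hQS, hye, hTe⟩ := hT
  obtain ⟨d, S₀, hd, hS₀n, hS₀, hxd⟩ := exists_rep hx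
  have hmem := mem_cover_iff hTe
  have hxy0 := ne_bot_iff.1 hxy
  rw [val_inf, hxd, hye] at hxy0
  obtain ⟨hde, W, hW, hWm, hxyW⟩ := eS_mul_eS X.isFiniteCover X.condI hd he hS₀ hS hxy0
  have hQS' := mem_insert_cov hS hQ
  have hval : (x ⊓ y).1 = eS (d ⊓ e) W := by rw [val_inf, hxd, hye, hxyW]
  -- membership in the product, pointwise
  have hb : ∀ p, p ≠ ⊥ → (Below (d ⊓ e) W p ↔ Below d S₀ p ∧ Below e S p) := by
    intro p hp
    rw [← ev_eS_iff hde hWm hp, ← hxyW, map_mul, ← ev_eS_iff hd hS₀ hp, ← ev_eS_iff he hS hp]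
    have h1 : ev p hp (eS d S₀) = 0 ∨ ev p hp (eS d S₀) = 1 := hxd ▸ ev_next x p hp
    have h2 : ev p hp (eS e S) = 0 ∨ ev p hp (eS e S) = 1 := hye ▸ ev_next y p hp
    rcases h1 with h1 | h1 <;> rcases h2 with h2 | h2 <;> simp [h1, h2]
  rcases X.condI d e hde Q hQ with hcase | hcase
  · -- `d ⊓ e = d ⊓ f` with `f ∈ Q`
    left
    obtain ⟨f, hf, hdf, -⟩ := mem_cut.1 hcase
    have heq : (x ⊓ y).1 = x.1 * (of f * eS e S) := by
      refine ext_ev fun p hp => ?_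
      rw [val_inf, hye, map_mul, map_mul, map_mul]
      have h1 : ev p hp x.1 = 0 ∨ ev p hp x.1 = 1 := ev_next x p hp
      have h2 : ev p hp (eS e S) = 0 ∨ ev p hp (eS e S) = 1 := hye ▸ ev_next y p hp
      rcases h1 with h1 | h1
      · simp [h1]
      rcases h2 with h2 | h2
      · simp [h2]
      have hpd : p ≤ d := ((ev_eS_iff hd hS₀ hp).1 (hxd ▸ h1)).1
      have hpe : p ≤ e := ((ev_eS_iff he hS hp).1 h2).1
      have hpf : p ≤ f := by
        have : p ≤ d ⊓ f := hdf ▸ le_inf hpd hpe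
        exact this.trans inf_le_right
      rw [ev_of, if_pos hpf, one_mul]
    have hne : of f * eS e S ≠ 0 := by
      intro h
      rw [h, mul_zero] at heq
      exact ne_bot_iff.1 hxy heq
    have : of f * eS e S ∈ nextCover e S Q := Or.inr ⟨f, hf, rfl, hne⟩
    rw [← hTe] at this
    obtain ⟨t, ht, htv⟩ := this
    refine mem_cut.2 ⟨t, ht, Next.ext ?_, hxy⟩
    rw [val_inf, htv, heq]
  · have hQ' : ∀ p, p ≠ ⊥ → p ≤ d → ((∀ f' ∈ cut d Q, ¬ p ≤ f') ↔ ∀ f ∈ Q, ¬ p ≤ f) := by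
      intro p hp hpd
      constructor
      · intro h f hf hpf
        have hle := le_inf hpd hpf
        exact h (d ⊓ f) (mem_cut.2 ⟨f, hf, rfl, ne_bot_of_le_ne_bot hp hle⟩) hle
      · intro h f' hf' hpf'
        obtain ⟨f, hf, rfl, -⟩ := mem_cut.1 hf'
        exact h f hf (hpf'.trans inf_le_right)
    have hins : x.1 * eS e (insert Q S) = eS (d ⊓ e) (insert (cut d Q) W) := by
      have hm := mem_insert_cov hWm hcase
      refine ext_ev fun p hp => ?_
      rw [hxd, ev_mul_ite (ev_eS (le_of_mem X.isFiniteCover hd hS₀) p hp)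
        (ev_eS (le_of_mem X.isFiniteCover he hQS') p hp),
        ev_eS (le_of_mem X.isFiniteCover hde hm) p hp]
      refine if_congr ?_ rfl rfl
      rw [below_insert, below_insert, hb p hp, and_assoc]
      refine and_congr_right fun h => and_congr_right fun _ => (hQ' p hp h.1).symm
    have hmul : ∀ f, x.1 * (of f * eS e S) = of (d ⊓ f) * eS (d ⊓ e) W := by
      intro f
      rw [← hxyW, hxd]
      refine ext_ev fun p hp => ?_
      have h1 := ev_eS_iff hd hS₀ hp
      rcases (hxd ▸ ev_next x p hp : ev p hp (eS d S₀) = 0 ∨ ev p hp (eS d S₀) = 1) with h0 | h0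
      · simp [h0]
      · have hpd := (h1.1 h0).1
        simp only [map_mul, h0, ev_of, le_inf_iff, hpd, true_and, one_mul]
    by_cases hQW : cut d Q ∈ W
    · left
      have heq : x.1 * eS e (insert Q S) = (x ⊓ y).1 := by
        rw [hins, Finset.insert_eq_of_mem hQW, hval]
      have : eS e (insert Q S) ∈ nextCover e S Q := by
        left; rw [Set.mem_singleton_iff]
      rw [← hTe] at this
      obtain ⟨t, ht, htv⟩ := this
      refine mem_cut.2 ⟨t, ht, Next.ext ?_, hxy⟩
      rw [val_inf, htv, heq]
    · right
      have hWn : W.Nonempty := by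
        obtain ⟨R, hR⟩ := hSn
        exact ⟨_, (hW _).2 (Or.inr ⟨R, hR, rfl⟩)⟩
      refine ⟨d ⊓ e, W, cut d Q, hde, hWn, hWm, hcase, hQW, hval, ?_⟩
      ext z
      constructor
      · rintro ⟨t', ht', rfl⟩
        obtain ⟨t, ht, rfl, hne⟩ := mem_cut.1 ht'
        rcases (hmem t).1 ht with h | ⟨f, hf, h, h0⟩
        · left
          have h : t.1 = eS e (insert Q S) := by convert! Set.mem_singleton_iff.1 h
          rw [Set.mem_singleton_iff, val_inf, h, hins]
        · right
          have hv : (x ⊓ t).1 = of (d ⊓ f) * eS (d ⊓ e) W := by rw [val_inf, h, hmul]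
          refine ⟨d ⊓ f, mem_cut.2 ⟨f, hf, rfl, fun hb => ne_bot_iff.1 hne ?_⟩, hv,
            ne_bot_iff.1 hne⟩
          rw [hv, hb, of_bot, zero_mul]
      · have key : ∀ w ∈ nextCover e S Q, x.1 * w ≠ 0 →
            x.1 * w ∈ Next.val '' (cut x T : Set X.Next) := by
          intro w hw hne
          rw [← hTe] at hw
          obtain ⟨t, ht, rfl⟩ := hw
          exact ⟨x ⊓ t, mem_cut.2 ⟨t, ht, rfl, ne_bot_iff.2 hne⟩, rfl⟩
        rintro (h | ⟨f', hf', h, h0⟩)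
        · have h : z = eS (d ⊓ e) (insert (cut d Q) W) := by convert! Set.mem_singleton_iff.1 h
          rw [h, ← hins]
          refine key _ (Or.inl ?_) ?_
          · rw [Set.mem_singleton_iff]
          · rw [hins]
            exact eS_ne_zero X.isFiniteCover X.condII hde (mem_insert_cov hWm hcase)
        · obtain ⟨f, hf, rfl, -⟩ := mem_cut.1 hf'
          rw [h, ← hmul] at h0 ⊢
          refine key _ (Or.inr ⟨f, hf, rfl, fun h => h0 ?_⟩) h0
          rw [h, mul_zero]

theorem supp_next_cover {x : X.Next} {T : Finset X.Next} {e : X.E} {S : Finset (Finset X.E)}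
    {Q : Finset X.E} (he : e ≠ ⊥) (hSn : S.Nonempty)
    (hS : ∀ R ∈ S, R ∈ X.cov e) (hQ : Q ∈ X.cov e) (hxe : x.1 = eS e S)
    (hTe : Next.val '' (T : Set X.Next) = nextCover e S Q)
    {a : X.Next} (ha : a ∈ supp (join T)) :
    (∀ p hp, ev p hp a.1 = 1 ↔ Below e S p ∧ ∀ f ∈ Q, ¬ p ≤ f) ∨
      ∃ q ∈ supp (join Q), ∀ p hp, ev p hp a.1 = 1 ↔ p ≤ q ∧ Below e S p := by
  classical
  have hQS' := mem_insert_cov hS hQ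
  let ψ : X.E → X.Next := fun q => ⟨of q * eS e S, of_mul_eS_mem X.isFiniteCover X.condI he hSn hS⟩
  have hψ0 : ψ ⊥ = ⊥ := Next.ext (by simp [ψ, of_bot, val_bot])
  have hψm : ∀ a b, ψ (a ⊓ b) = ψ a ⊓ ψ b := by
    intro a b
    refine Next.ext ?_
    have hx2 : eS e S * eS e S = eS e S := by
      rw [← hxe]; exact mul_self_of_mem X.isFiniteCover x.2
    change of (a ⊓ b) * eS e S = of a * eS e S * (of b * eS e S)
    rw [← of_mul_of, mul_mul_mul_comm, hx2]
  let Ψ : ZReg X.E →ₙ+* ZReg X.Next := lift (fun q => of (ψ q)) (by rw [hψ0, of_bot])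
    (fun a b => by rw [hψm, of_mul_of])
  have hΨ : ∀ q, Ψ (of q) = of (ψ q) := fun q => lift_of _ _ _ q
  let c : X.Next := ⟨eS e (insert Q S), Or.inl ⟨e, _, he, by simp, hQS', rfl⟩⟩
  have hψle : ∀ f, ψ f ≠ ⊥ → f ∈ Q → ψ f ∈ T := by
    intro f hf hfQ
    rw [mem_cover_iff hTe]
    exact Or.inr ⟨f, hfQ, rfl, ne_bot_iff.1 hf⟩
  have hcT : c ∈ T := by
    rw [mem_cover_iff hTe]
    left; rw [Set.mem_singleton_iff]
  have hdisj : ∀ f ∈ Q, c ⊓ ψ f = ⊥ := by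
    intro f hf
    by_contra hne
    obtain ⟨p, hp, h⟩ := exists_ev_of_ne hne
    have h1 := le_iff_ev.1 (inf_le_left : c ⊓ ψ f ≤ c) p hp h
    have h2 := le_iff_ev.1 (inf_le_right : c ⊓ ψ f ≤ ψ f) p hp h
    exact (below_insert.1 ((ev_eS_iff he hQS' hp).1 h1)).2 f hf ((ev_of_mul_iff he hS hp).1 h2).1
  have hjoin : join T = of c + Ψ (join Q) := by
    refine ext_ev fun P hP => ?_
    have h2 : ev P hP (Ψ (join Q)) = if ∃ f ∈ Q, P ≤ ψ f then 1 else 0 :=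
      hom_join ((ev P hP).comp Ψ) (fun q => P ≤ ψ q) (fun q => by
        rw [NonUnitalRingHom.comp_apply, hΨ, ev_of]) Q
    rw [map_add, h2, ev_join, ev_of]
    have hiff : (∃ t ∈ T, P ≤ t) ↔ (P ≤ c ∨ ∃ f ∈ Q, P ≤ ψ f) := by
      constructor
      · rintro ⟨t, ht, hPt⟩
        rcases (mem_cover_iff hTe t).1 ht with h | ⟨f, hf, h, -⟩
        · left
          have : t = c := Next.ext (by convert! Set.mem_singleton_iff.1 h)
          exact this ▸ hPt
        · right
          have : t = ψ f := Next.ext h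
          exact ⟨f, hf, this ▸ hPt⟩
      · rintro (h | ⟨f, hf, h⟩)
        · exact ⟨c, hcT, h⟩
        · exact ⟨ψ f, hψle f (ne_bot_of_le_ne_bot hP h) hf, h⟩
    by_cases h3 : P ≤ c
    · have h4 : ¬ ∃ f ∈ Q, P ≤ ψ f := by
        rintro ⟨f, hf, h⟩
        exact hP (le_bot_iff.1 (hdisj f hf ▸ le_inf h3 h))
      rw [if_pos (hiff.2 (Or.inl h3)), if_pos h3, if_neg h4, add_zero]
    · rw [if_neg h3, zero_add]
      exact if_congr (hiff.trans (or_iff_right h3)) rfl rfl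
  rw [hjoin] at ha
  rcases supp_add ha with ha | ha
  · left
    intro p hp
    rw [supp_of ha]
    exact (ev_eS_iff he hQS' hp).trans below_insert
  · right
    obtain ⟨q, hq, rfl⟩ := supp_lift Ψ ψ hΨ ha
    exact ⟨q, hq, fun p hp => ev_of_mul_iff he hS hp⟩

theorem ev_prodBelow {ι : Type*} (x : X.Next) (s : Finset ι) (ε : ι → X.Next) (p : X.E)
    (hp : p ≠ ⊥) : ev p hp (prodBelow x s ε).1 = 1 ↔
      ev p hp x.1 = 1 ∧ ∀ i ∈ s, ev p hp (ε i).1 = 1 := by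
  classical
  unfold prodBelow
  induction s using Finset.induction_on with
  | empty => simp
  | insert i s hi ih =>
    rw [Finset.fold_insert hi, val_inf, map_mul]
    simp only [Finset.mem_insert, forall_eq_or_imp]
    rw [← and_assoc, and_comm (a := ev p hp x.1 = 1), and_assoc, ← ih]
    rcases ev_next (ε i) p hp with h1 | h1 <;> simp [h1]

theorem next_condII : CondII X.nextCov := by
  classical
  intro x hx 𝒯 h𝒯 ε hε T₀ hT₀ hne
  obtain ⟨e, S, he, hSn, hS, hxe⟩ := exists_rep hx
  -- the covers of `e` that describe the given covers
  have hrep : ∀ T ∈ 𝒯, ∃ Q, Q ∈ X.cov e ∧ Q ∉ S ∧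
      Next.val '' (T : Set X.Next) = nextCover e S Q := by
    intro T hT
    obtain ⟨e', S', Q, he', -, hS', hQ, hQS, hxe', hTe⟩ := h𝒯 T hT
    obtain ⟨rfl, rfl⟩ := eS_inj X.isFiniteCover X.condII he he' hS hS' (hxe ▸ hxe')
    exact ⟨Q, hQ, hQS, hTe⟩
  choose! Q hQc hQS hQT using hrep
  have hQinj : ∀ T ∈ 𝒯, ∀ T' ∈ 𝒯, Q T = Q T' → T = T' := by
    intro T hT T' hT' h
    have h1 := hQT T hT
    rw [h, ← hQT T' hT'] at h1
    have hinj : Function.Injective (Next.val : X.Next → _) := fun a b h => Next.ext h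
    exact Finset.coe_injective (hinj.image_injective h1)
  have hsupp := fun T hT => supp_next_cover he hSn hS (hQc T hT) hxe (hQT T hT) (hε T hT)
  -- the indices for which a support element of the old cover is chosen
  let IsB : Finset X.Next → Prop := fun T =>
    ∀ p hp, ev p hp (ε T).1 = 1 ↔ Below e S p ∧ ∀ f ∈ Q T, ¬ p ≤ f
  have hqex : ∀ T ∈ 𝒯, ¬ IsB T →
      ∃ q ∈ supp (join (Q T)), ∀ p hp, ev p hp (ε T).1 = 1 ↔ p ≤ q ∧ Below e S p :=
    fun T hT hB => (hsupp T hT).resolve_left hB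
  choose! q hqs hqe using hqex
  let A := (𝒯.erase T₀).filter (fun T => ¬ IsB T)
  have hA : ∀ T, T ∈ A ↔ (T ≠ T₀ ∧ T ∈ 𝒯) ∧ ¬ IsB T := by
    intro T; simp [A]
  -- transport of the choice to the covers of `e`
  let ε' : Finset X.E → X.E := fun R => if h : ∃ T ∈ 𝒯, Q T = R then q h.choose else ⊥
  have hε' : ∀ T ∈ 𝒯, ε' (Q T) = q T := by
    intro T hT
    have h : ∃ T' ∈ 𝒯, Q T' = Q T := ⟨T, hT, rfl⟩
    simp only [ε', dif_pos h]
    rw [hQinj _ h.choose_spec.1 T hT h.choose_spec.2]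
  let SA := A.image Q
  have hSA : ∀ R ∈ SA, R ∈ X.cov e := by
    intro R hR
    obtain ⟨T, hT, rfl⟩ := Finset.mem_image.1 hR
    exact hQc T ((hA T).1 hT).1.2
  have hSAε : ∀ R ∈ SA, ε' R ∈ supp (join R) := by
    intro R hR
    obtain ⟨T, hT, rfl⟩ := Finset.mem_image.1 hR
    have := (hA T).1 hT
    rw [hε' T this.1.2]
    exact hqs T this.1.2 this.2
  have hSAS : ∀ R ∈ S, R ∉ SA := by
    intro R hR h
    obtain ⟨T, hT, rfl⟩ := Finset.mem_image.1 h
    exact hQS T ((hA T).1 hT).1.2 hR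
  have hBdisj : ∀ T ∈ 𝒯, T ∉ A → Q T ∉ SA := by
    intro T hT hTA h
    obtain ⟨T', hT', h⟩ := Finset.mem_image.1 h
    exact hTA (hQinj T' ((hA T').1 hT').1.2 T hT h ▸ hT')
  have hT₀A : T₀ ∉ A := fun h => ((hA T₀).1 h).1.1 rfl
  -- the pointwise description of the product over the other indices
  have hprod : ∀ p (hp : p ≠ ⊥), ev p hp (prodBelow x (𝒯.erase T₀) ε).1 = 1 ↔
      Below e S p ∧ (∀ R ∈ SA, p ≤ ε' R) ∧
        ∀ T ∈ 𝒯, T ≠ T₀ → IsB T → ∀ f ∈ Q T, ¬ p ≤ f := by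
    intro p hp
    rw [ev_prodBelow, hxe, ev_eS_iff he hS hp]
    refine and_congr_right fun hpS => ?_
    constructor
    · intro h
      refine ⟨fun R hR => ?_, fun T hT hne hB f hf => ?_⟩
      · obtain ⟨T, hT, rfl⟩ := Finset.mem_image.1 hR
        have hT' := (hA T).1 hT
        rw [hε' T hT'.1.2]
        exact ((hqe T hT'.1.2 hT'.2 p hp).1 (h T (Finset.mem_erase.2 hT'.1))).1
      · exact ((hB p hp).1 (h T (Finset.mem_erase.2 ⟨hne, hT⟩))).2 f hf
    · rintro ⟨h1, h2⟩ T hT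
      have hT' := Finset.mem_erase.1 hT
      by_cases hB : IsB T
      · exact (hB p hp).2 ⟨hpS, h2 T hT'.2 hT'.1 hB⟩
      · refine (hqe T hT'.2 hB p hp).2 ⟨?_, hpS⟩
        rw [← hε' T hT'.2]
        exact h1 _ (Finset.mem_image_of_mem Q ((hA T).2 ⟨hT', hB⟩))
  obtain ⟨p₀, hp₀, hev₀⟩ := exists_ev_of_ne hne
  obtain ⟨hb₀, hle₀, -⟩ := (hprod p₀ hp₀).1 hev₀
  have hp₀' : p₀ ≤ prodBelow e SA ε' := le_prodBelow.2 ⟨hb₀.1, hle₀⟩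
  -- a criterion for points to lie in the product
  have hcrit : ∀ (S₁ : Finset (Finset X.E)) (ε₁ : Finset X.E → X.E), SA ⊆ S₁ →
      S₁ ⊆ insert (Q T₀) SA → (∀ R ∈ SA, ε₁ R = ε' R) → (∀ R ∈ S₁, ε₁ R ∈ supp (join R)) →
      prodBelow e S₁ ε₁ ≠ ⊥ →
      ∀ hp, ev (prodBelow e S₁ ε₁) hp (prodBelow x (𝒯.erase T₀) ε).1 = 1 := by
    intro S₁ ε₁ h1 h2 h3 h4 h5 hp
    have hS₁ : ∀ R ∈ S₁, R ∈ X.cov e := by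
      intro R hR
      rcases Finset.mem_insert.1 (h2 hR) with rfl | h
      · exact hQc T₀ hT₀
      · exact hSA R h
    rw [hprod _ hp]
    refine ⟨below_prod X.isFiniteCover X.condII he hS₁ h4 h5 hS ?_, ?_, ?_⟩
    · intro R hR hR1
      rcases Finset.mem_insert.1 (h2 hR1) with rfl | h
      · exact hQS T₀ hT₀ hR
      · exact hSAS R hR h
    · intro R hR
      rw [← h3 R hR]
      exact (le_prodBelow.1 le_rfl).2 R (h1 hR)
    · intro T hT hne hB f hf
      refine not_le_of_prod X.isFiniteCover X.condII he hS₁ h4 h5 (hQc T hT) (fun h => ?_) hf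
      rcases Finset.mem_insert.1 (h2 h) with h | h
      · exact hne (hQinj T hT T₀ hT₀ h)
      · exact hBdisj T hT (fun h => ((hA T).1 h).2 hB) h
  have hp : prodBelow e SA ε' ≠ ⊥ := ne_bot_of_le_ne_bot hp₀ hp₀'
  have hle : prodBelow x 𝒯 ε ≤ prodBelow x (𝒯.erase T₀) ε := by
    rw [le_prodBelow]
    have := (le_prodBelow (p := prodBelow x 𝒯 ε) (e := x) (s := 𝒯) (ε := ε)).1 le_rfl
    exact ⟨this.1, fun i hi => this.2 i (Finset.mem_of_mem_erase hi)⟩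
  refine lt_of_le_of_ne hle fun heq => ?_
  have hmem : ∀ p hp, ev p hp (prodBelow x (𝒯.erase T₀) ε).1 = 1 → ev p hp (ε T₀).1 = 1 := by
    intro p hp h
    rw [← heq, ev_prodBelow] at h
    exact h.2 T₀ hT₀
  by_cases hB : IsB T₀
  · obtain ⟨f, hf, hpf⟩ := (X.isFiniteCover e he _ (hQc T₀ hT₀)).2 _ hp (le_prodBelow.1 le_rfl).1
    obtain ⟨δ, hδ, hfδ⟩ := exists_supp X.isFiniteCover he (hQc T₀ hT₀) hf
    have hQ₀ := hBdisj T₀ hT₀ hT₀A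
    have h3 : ∀ R ∈ SA, Function.update ε' (Q T₀) δ R = ε' R := fun R hR =>
      Function.update_of_ne (fun h : R = Q T₀ => hQ₀ (h ▸ hR)) _ _
    have h5 : prodBelow e (insert (Q T₀) SA) (Function.update ε' (Q T₀) δ) ≠ ⊥ := by
      refine ne_bot_of_le_ne_bot hpf (le_prodBelow.2 ⟨?_, fun R hR => ?_⟩)
      · exact inf_le_left.trans (le_prodBelow.1 le_rfl).1
      · rcases Finset.mem_insert.1 hR with rfl | hR
        · rw [Function.update_self]; exact inf_le_right.trans hfδ
        · rw [h3 R hR]; exact inf_le_left.trans ((le_prodBelow.1 le_rfl).2 R hR)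
    have := hmem _ h5 (hcrit (insert (Q T₀) SA) (Function.update ε' (Q T₀) δ)
      (Finset.subset_insert _ _) subset_rfl h3 (fun R hR => by
        rcases Finset.mem_insert.1 hR with rfl | hR
        · rw [Function.update_self]; exact hδ
        · rw [h3 R hR]; exact hSAε R hR) h5 h5)
    obtain ⟨f', hf', hδf⟩ := supp_join hδ
    refine ((hB _ h5).1 this).2 f' hf' (le_trans ?_ hδf)
    have := (le_prodBelow (p := prodBelow e (insert (Q T₀) SA) (Function.update ε' (Q T₀) δ))).1 le_rfl
    simpa using this.2 (Q T₀) (Finset.mem_insert_self _ _)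
  · have h1 := hmem _ hp (hcrit SA ε' subset_rfl (Finset.subset_insert _ _) (fun _ _ => rfl) hSAε hp hp)
    have h2 := ((hqe T₀ hT₀ hB _ hp).1 h1).1
    obtain ⟨f, hf, hqf⟩ := supp_join (hqs T₀ hT₀ hB)
    exact not_le_of_prod X.isFiniteCover X.condII he hSA hSAε hp (hQc T₀ hT₀)
      (hBdisj T₀ hT₀ hT₀A) hf (h2.trans hqf)

theorem ev_autMap {φ : X.E ≃o X.E} (x : ZReg X.E) {p : X.E} (hp : p ≠ ⊥) (hp' : φ.symm p ≠ ⊥) :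
    ev p hp (autMap φ x) = ev (φ.symm p) hp' x := by
  classical
  refine hom_ext (f := (ev p hp).comp (map φ)) (g := ev (φ.symm p) hp') (fun e => ?_) x
  rw [NonUnitalRingHom.comp_apply, map_of, ev_of, ev_of]
  exact if_congr (OrderIso.symm_apply_le φ).symm rfl rfl

/-- The image of a finite set under an automorphism. -/
def mapFin (φ : X.E ≃o X.E) : Finset X.E ↪ Finset X.E :=
  ⟨fun R => R.map φ.toEquiv.toEmbedding, Finset.map_injective _⟩

theorem mapFin_mem (g : Γ) {e : X.E} (he : e ≠ ⊥) {R : Finset X.E} (hR : R ∈ X.cov e) :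
    mapFin (X.τ g) R ∈ X.cov (X.τ g e) := by
  rw [← X.condIII g e he]
  exact ⟨R, hR, rfl⟩

theorem mapFin_mem_all (g : Γ) {e : X.E} (he : e ≠ ⊥) {S : Finset (Finset X.E)}
    (hS : ∀ R ∈ S, R ∈ X.cov e) : ∀ R ∈ S.map (mapFin (X.τ g)), R ∈ X.cov (X.τ g e) := by
  intro R' hR'
  obtain ⟨R, hR, rfl⟩ := Finset.mem_map.1 hR'
  exact mapFin_mem g he (hS R hR)

theorem map_ne_bot (φ : X.E ≃o X.E) {e : X.E} (he : e ≠ ⊥) : φ e ≠ ⊥ := by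
  simpa using he

theorem autMap_eS (g : Γ) {e : X.E} (he : e ≠ ⊥) {S : Finset (Finset X.E)}
    (hS : ∀ R ∈ S, R ∈ X.cov e) :
    autMap (X.τ g) (eS e S) = eS (X.τ g e) (S.map (mapFin (X.τ g))) := by
  classical
  refine ext_ev fun p hp => ?_
  have hp' := map_ne_bot (X.τ g).symm hp
  rw [ev_autMap _ hp hp', ev_eS (le_of_mem X.isFiniteCover he hS),
    ev_eS (le_of_mem X.isFiniteCover (map_ne_bot _ he) (mapFin_mem_all g he hS))]
  refine if_congr ?_ rfl rfl
  unfold Below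
  rw [OrderIso.symm_apply_le]
  refine and_congr_right fun _ => ?_
  constructor
  · intro h R' hR' f' hf'
    obtain ⟨R, hR, rfl⟩ := Finset.mem_map.1 hR'
    obtain ⟨f, hf, rfl⟩ := Finset.mem_map.1 hf'
    exact fun hpf => h R hR f hf ((OrderIso.symm_apply_le _).2 hpf)
  · intro h R hR f hf hpf
    exact h _ (Finset.mem_map.2 ⟨R, hR, rfl⟩) _ (Finset.mem_map.2 ⟨f, hf, rfl⟩)
      ((OrderIso.symm_apply_le _).1 hpf)

theorem autMap_mem (g : Γ) {x : ZReg X.E} (hx : x ∈ nextSet X.cov) :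
    autMap (X.τ g) x ∈ nextSet X.cov := by
  rcases hx with ⟨e, S, he, hSn, hS, rfl⟩ | hx
  · rw [autMap_eS g he hS]
    exact Or.inl ⟨_, _, map_ne_bot _ he, hSn.map, mapFin_mem_all g he hS, rfl⟩
  · rw [Set.mem_singleton_iff.1 hx, map_zero]; exact Or.inr rfl

variable (X)

/-- The action of `Γ` on `ℤ[Eˣ]` induced by the action on `E`. -/
noncomputable def act : Γ →* RingAut (ZReg X.E) := autMap.comp X.τ

variable {X}

theorem act_mem (g : Γ) {x : ZReg X.E} (hx : x ∈ nextSet X.cov) : X.act g x ∈ nextSet X.cov :=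
  autMap_mem g hx

theorem act_inv_act (g : Γ) (x : ZReg X.E) : X.act g⁻¹ (X.act g x) = x := by
  have := DFunLike.congr_fun (map_mul X.act g⁻¹ g) x
  rw [inv_mul_cancel, map_one] at this
  exact this.symm

theorem act_act_inv (g : Γ) (x : ZReg X.E) : X.act g (X.act g⁻¹ x) = x := by
  have := act_inv_act g⁻¹ x
  rwa [inv_inv] at this

variable (X)

/-- The action of `Γ` on `E(E, 𝓡)`: the restriction of the action on `ℤ[Eˣ]`. -/
noncomputable def nextAct : Γ →* (X.Next ≃o X.Next) where
  toFun g :=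
    { toFun := fun a => ⟨X.act g a.1, act_mem g a.2⟩
      invFun := fun a => ⟨X.act g⁻¹ a.1, act_mem g⁻¹ a.2⟩
      left_inv := fun a => Next.ext (act_inv_act g a.1)
      right_inv := fun a => Next.ext (act_act_inv g a.1)
      map_rel_iff' := fun {a b} => by
        rw [next_le_iff, next_le_iff]
        change X.act g a.1 * X.act g b.1 = X.act g a.1 ↔ _
        rw [← map_mul, EmbeddingLike.apply_eq_iff_eq] }
  map_one' := by
    refine RelIso.ext fun a => ?_
    exact Next.ext <| congrArg (fun f : RingAut (ZReg X.E) => f a.1) (map_one X.act)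
  map_mul' g h := by
    refine RelIso.ext fun a => ?_
    exact Next.ext <| congrArg (fun f : RingAut (ZReg X.E) => f a.1) (map_mul X.act g h)

variable {X}

theorem val_nextAct (g : Γ) (a : X.Next) : (X.nextAct g a).1 = X.act g a.1 := rfl

theorem act_of (g : Γ) (e : X.E) : X.act g (of e) = of (X.τ g e) := autMap_of (X.τ g) e

theorem act_nextCover (g : Γ) {e : X.E} (he : e ≠ ⊥) {S : Finset (Finset X.E)} {Q : Finset X.E}
    (hS : ∀ R ∈ S, R ∈ X.cov e) (hQ : Q ∈ X.cov e) :
    X.act g '' nextCover e S Q =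
      nextCover (X.τ g e) (S.map (mapFin (X.τ g))) (mapFin (X.τ g) Q) := by
  classical
  have h1 : X.act g (eS e S) = eS (X.τ g e) (S.map (mapFin (X.τ g))) := autMap_eS g he hS
  have h2 : X.act g (eS e (insert Q S)) =
      eS (X.τ g e) (insert (mapFin (X.τ g) Q) (S.map (mapFin (X.τ g)))) := by
    rw [← Finset.map_insert]
    exact autMap_eS g he (mem_insert_cov hS hQ)
  unfold nextCover
  rw [Set.image_union, Set.image_singleton]
  congr 1
  · rw [Set.singleton_eq_singleton_iff]
    convert! h2
  · ext z
    constructor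
    · rintro ⟨x, ⟨f, hf, rfl, h0⟩, rfl⟩
      refine ⟨X.τ g f, Finset.mem_map.2 ⟨f, hf, rfl⟩, ?_, ?_⟩
      · rw [map_mul, h1, act_of]
      · exact (map_ne_zero_iff _ (X.act g).injective).2 h0
    · rintro ⟨f', hf', rfl, h0⟩
      obtain ⟨f, hf, rfl⟩ := Finset.mem_map.1 hf'
      have h3 : X.act g (of f * eS e S) =
          of (X.τ g f) * eS (X.τ g e) (S.map (mapFin (X.τ g))) := by rw [map_mul, h1, act_of]
      refine ⟨of f * eS e S, ⟨f, hf, rfl, fun h => h0 ?_⟩, h3⟩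
      have h4 := h3
      rw [h, map_zero] at h4
      exact h4.symm

theorem nextCov_map (g : Γ) {x : X.Next} {T : Finset X.Next} (hT : T ∈ X.nextCov x) :
    T.map (X.nextAct g).toEquiv.toEmbedding ∈ X.nextCov (X.nextAct g x) := by
  obtain ⟨e, S, Q, he, hSn, hS, hQ, hQS, hxe, hTe⟩ := hT
  refine ⟨X.τ g e, S.map (mapFin (X.τ g)), mapFin (X.τ g) Q, map_ne_bot _ he, hSn.map,
    mapFin_mem_all g he hS, mapFin_mem g he hQ, ?_, ?_, ?_⟩
  · rwa [Finset.mem_map']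
  · rw [val_nextAct, hxe]; exact autMap_eS g he hS
  · rw [← act_nextCover g he hS hQ, ← hTe, Finset.coe_map, Set.image_image, Set.image_image]
    rfl

theorem next_condIII : CondIII X.nextAct X.nextCov := by
  intro g x _
  ext T
  constructor
  · rintro ⟨T, hT, rfl⟩
    exact nextCov_map g hT
  · intro hT
    refine ⟨T.map (X.nextAct g⁻¹).toEquiv.toEmbedding, ?_, ?_⟩
    · have := nextCov_map g⁻¹ hT
      have hx : X.nextAct g⁻¹ (X.nextAct g x) = x := Next.ext (act_inv_act g x.1)
      rwa [hx] at this
    · change Finset.map _ (Finset.map _ T) = T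
      rw [Finset.map_map]
      convert! Finset.map_refl
      refine Function.Embedding.ext fun a => ?_
      exact Next.ext (act_act_inv g a.1)

variable (X)

/-- The `Γ`-semilattice `E(E, 𝓡)` with its collection `𝓡(E, 𝓡)` of finite covers, which again
satisfies the conditions (i), (ii) and (iii). -/
noncomputable def next : CoverSystem.{u, v} Γ where
  E := X.Next
  τ := X.nextAct
  cov := X.nextCov
  isFiniteCover := next_isFiniteCover
  condI := next_condI
  condII := next_condII
  condIII := next_condIII

/-- The iterates: `iter 0 = (E, 𝓡)` and `iter (k + 1) = (E(E_k, 𝓡_k), 𝓡(E_k, 𝓡_k))`. -/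
noncomputable def iter : ℕ → CoverSystem.{u, v} Γ
  | 0 => X
  | k + 1 => (iter k).next

/-- The ring homomorphism `ℤ[E(E, 𝓡)ˣ] → ℤ[Eˣ]` induced by the inclusion of `E(E, 𝓡)` into the
idempotents of `ℤ[Eˣ]`. -/
noncomputable def incl : ZReg X.next.E →ₙ+* ZReg X.E :=
  lift (E := X.Next) Next.val val_bot val_inf

/-- The homomorphism `ℤ[E_{k+1}ˣ] → ℤ[E_kˣ]`. -/
noncomputable def boundary (k : ℕ) : ZReg (X.iter (k + 1)).E →ₙ+* ZReg (X.iter k).E :=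
  (X.iter k).incl

/-- The relations `e - ⋁ R`, for `e ∈ Eˣ` and `R ∈ 𝓡(e)`. -/
def relations : Set (ZReg X.E) :=
  {x | ∃ e : X.E, e ≠ ⊥ ∧ ∃ R ∈ X.cov e, x = of e - join R}

variable {X}

theorem of_mul_rel (d : X.E) {x : ZReg X.E} (hx : x ∈ AddSubgroup.closure X.relations) :
    of d * x ∈ AddSubgroup.closure X.relations := by
  classical
  induction hx using AddSubgroup.closure_induction with
  | zero => rw [mul_zero]; exact zero_mem _
  | add x y _ _ hx hy => rw [mul_add]; exact add_mem hx hy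
  | neg x _ hx => rw [mul_neg]; exact neg_mem hx
  | mem x hx =>
    obtain ⟨e, he, R, hR, rfl⟩ := hx
    have hjoin : of d * join R = join (cut d R) := by
      refine ext_ev fun p hp => ?_
      rw [ev_mul_ite (ev_of p hp d) (ev_join p hp R), ev_join]
      refine if_congr ?_ rfl rfl
      constructor
      · rintro ⟨hpd, f, hf, hpf⟩
        have := le_inf hpd hpf
        exact ⟨d ⊓ f, mem_cut.2 ⟨f, hf, rfl, ne_bot_of_le_ne_bot hp this⟩, this⟩
      · rintro ⟨f', hf', hpf'⟩
        obtain ⟨f, hf, rfl, -⟩ := mem_cut.1 hf'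
        exact ⟨hpf'.trans inf_le_left, f, hf, hpf'.trans inf_le_right⟩
    rw [mul_sub, of_mul_of, hjoin]
    have hle := fun f hf => ((X.isFiniteCover e he R hR).1 f hf).2
    have hz : ((∀ p, p ≠ ⊥ → p ≤ d ⊓ e → ∃ f ∈ cut d R, p ≤ f)) →
        of (d ⊓ e) - join (cut d R) ∈ AddSubgroup.closure X.relations := by
      intro h
      have : of (d ⊓ e) - join (cut d R) = 0 := by
        refine eq_zero_of_ev fun p hp => ?_
        rw [map_sub, ev_of, ev_join, sub_eq_zero]
        refine if_congr ⟨h p hp, ?_⟩ rfl rfl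
        rintro ⟨f', hf', hpf'⟩
        obtain ⟨f, hf, rfl, -⟩ := mem_cut.1 hf'
        exact hpf'.trans (inf_le_inf_left d (hle f hf))
      rw [this]; exact zero_mem _
    by_cases hde : d ⊓ e = ⊥
    · exact hz fun p hp h => absurd (le_bot_iff.1 (hde ▸ h)) hp
    · rcases X.condI d e hde R hR with h | h
      · exact hz fun p _ hpde => ⟨_, h, hpde⟩
      · exact AddSubgroup.subset_closure ⟨_, hde, _, h, rfl⟩

theorem mul_rel (y : ZReg X.E) {x : ZReg X.E} (hx : x ∈ AddSubgroup.closure X.relations) :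
    y * x ∈ AddSubgroup.closure X.relations := by
  induction y using ZReg.induction with
  | hof e => exact of_mul_rel e hx
  | hadd a b ha hb => rw [add_mul]; exact add_mem ha hb
  | hneg a ha => rw [neg_mul]; exact neg_mem ha

variable (X)

/-- The ideal `I` of `ℤ[Eˣ]`: the `ℤ`-span of the relations `e - ⋁ R`. -/
noncomputable def relIdeal : TwoSidedIdeal (ZReg X.E) :=
  TwoSidedIdeal.mk' (AddSubgroup.closure X.relations : Set (ZReg X.E)) (zero_mem _)
    (fun hx hy => add_mem hx hy) (fun hx => neg_mem hx) (fun hy => mul_rel _ hy)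
    (fun hx => by rw [mul_comm]; exact mul_rel _ hx)

/-- The quotient ring `ℤ[Eˣ] / I`. -/
abbrev Quot : Type u := X.relIdeal.ringCon.Quotient

/-- The canonical projection `ℤ[Eˣ] → ℤ[Eˣ] / I`. -/
noncomputable def proj : ZReg X.E →ₙ+* X.Quot where
  toFun x := (x : X.relIdeal.ringCon.Quotient)
  map_zero' := rfl
  map_add' _ _ := rfl
  map_mul' _ _ := rfl

end CoverSystem
end IndRes

/-! The characters `ev p` separate the points of `ℤ[Eˣ]`, and `e(S)` takes under them the value 1
exactly at those `p ≤ e` that lie below no element of a cover in `S`, and 0 otherwise. Identities in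
`ℤ[Eˣ]` are therefore checked pointwise.

Since all levels of the iteration are built in the same way, exactness reduces to two statements
about a single system: the image of `ℤ[E(E, 𝓡)ˣ] → ℤ[Eˣ]` is the span of the relations `e - ⋁ R`
(`mem_range_inclNext`), and its kernel is the span of the relations of the next system
(`inclNext_eq_zero_iff`). The image statement for the next system then matches the kernel statement
for the current one.

For the image, every `e(S)` has a factor `e - ⋁ R`, and the span of these relations is an ideal;
conversely, `e - ⋁ R` is `e({R})`.

For the kernel, a given `x` involves only finitely many elements of `E`, so one works in a finite
subset `F` closed under products. For each `e` having a cover inside `F`, select one such cover `c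
e`. The relation attached to `R(S, Q)` expresses `e(S) - e(S ∪ {Q})` as a combination of terms `q
e(S)`, with `q` a product of elements of `Q` (`of_sub_of_mem`). By (ii) one has `q < e`, and by (i)
a nonzero `q e(S)` is some `q(S')` still living in `F`. Induction over `F` shows that, modulo the
relations, each `e(S)` is a combination of the selected elements `d({c d})`
(`of_mem_of_isSupportedAt`). The latter are linearly independent in `ℤ[Eˣ]`, because `d({c d})` has
value 1 at `d` and vanishes at all points not below `d` (`eq_zero_of_inclNext_eq_zero`). Hence an
element of the kernel has no selected part and is a combination of relations. -/

namespace IndRes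
namespace CoverSystem

open ZReg

/-! ### The map to `ℤ[Eˣ]` and the relations of the next system. -/

variable {Γ : Type v} [Group Γ] {X : CoverSystem.{u, v} Γ}

variable (X)

/-- The homomorphism `incl`, stated for the underlying set `E(E, 𝓡)` of the next semilattice. -/
noncomputable def inclNext : ZReg X.Next →ₙ+* ZReg X.E := lift Next.val val_bot val_inf

/-- The relations `x - ⋁ T` for `x` in `E(E, 𝓡)ˣ` and `T` in `𝓡(E, 𝓡)(x)`. -/
def nextRelations : Set (ZReg X.Next) :=
  {z | ∃ x : X.Next, x ≠ ⊥ ∧ ∃ T ∈ X.nextCov x, z = of x - join T}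

variable {X}

theorem inclNext_of (a : X.Next) : X.inclNext (of a) = a.1 := lift_of _ _ _ a

/-! ### Exactness at `ℤ[Eˣ]` -/

theorem eS_singleton {e : X.E} (he : e ≠ ⊥) {R : Finset X.E} (hR : R ∈ X.cov e) :
    eS e {R} = of e - join R := by
  classical
  have hle := fun f hf => ((X.isFiniteCover e he R hR).1 f hf).2
  refine ext_ev fun p hp => ?_
  rw [ev_eS (by simpa using hle), map_sub, ev_of, ev_join]
  simp only [Below, Finset.mem_singleton, forall_eq]
  by_cases h2 : ∃ f ∈ R, p ≤ f
  · obtain ⟨f, hf, hpf⟩ := h2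
    have h3 : ¬ ∀ f ∈ R, ¬ p ≤ f := fun h => h f hf hpf
    rw [if_neg (fun h => h3 h.2), if_pos (hpf.trans (hle f hf)), if_pos ⟨f, hf, hpf⟩, sub_self]
  · have h3 : ∀ f ∈ R, ¬ p ≤ f := by push Not at h2; exact h2
    rw [if_neg h2, sub_zero]
    exact if_congr (and_iff_left h3) rfl rfl

/-- One factor `e - ⋁ R` can be split off the product, and the span of the relations absorbs
multiplication by the rest. -/
theorem eS_mem_closure_relations {e : X.E} (he : e ≠ ⊥) {S : Finset (Finset X.E)}
    (hSn : S.Nonempty) (hS : ∀ R ∈ S, R ∈ X.cov e) :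
    eS e S ∈ AddSubgroup.closure X.relations := by
  classical
  obtain ⟨R, hR⟩ := hSn
  rw [← Finset.insert_erase hR, eS, Finset.fold_insert (Finset.notMem_erase R S), mul_comm]
  exact mul_rel _ (AddSubgroup.subset_closure ⟨e, he, R, hS R hR, rfl⟩)

/-- This serves twice: with `proj_eq_zero_iff` it gives exactness at `ℤ[Eˣ]`, and applied to the
next system it describes the image that has to match the kernel computed below. -/
theorem mem_range_inclNext (x : ZReg X.E) :
    x ∈ Set.range X.inclNext ↔ x ∈ AddSubgroup.closure X.relations := by
  constructor
  · rintro ⟨y, rfl⟩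
    induction y using ZReg.induction with
    | hof a =>
      rw [inclNext_of]
      rcases a.2 with ⟨e, S, he, hSn, hS, h⟩ | h
      · rw [h]; exact eS_mem_closure_relations he hSn hS
      · rw [Set.mem_singleton_iff.1 h]; exact zero_mem _
    | hadd a b ha hb => rw [map_add]; exact add_mem ha hb
    | hneg a ha => rw [map_neg]; exact neg_mem ha
  · intro h
    induction h using AddSubgroup.closure_induction with
    | zero => exact ⟨0, map_zero _⟩
    | add x y _ _ hx hy =>
      obtain ⟨a, rfl⟩ := hx
      obtain ⟨b, rfl⟩ := hy
      exact ⟨a + b, map_add _ _ _⟩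
    | neg x _ hx =>
      obtain ⟨a, rfl⟩ := hx
      exact ⟨-a, map_neg _ _⟩
    | mem x hx =>
      obtain ⟨e, he, R, hR, rfl⟩ := hx
      have hR' : ∀ R' ∈ ({R} : Finset (Finset X.E)), R' ∈ X.cov e := by simpa using hR
      exact ⟨of (⟨eS e {R}, Or.inl ⟨e, _, he, by simp, hR', rfl⟩⟩ : X.Next),
        (inclNext_of _).trans (eS_singleton he hR)⟩

theorem mem_relIdeal (x : ZReg X.E) : x ∈ X.relIdeal ↔ x ∈ AddSubgroup.closure X.relations :=
  TwoSidedIdeal.mem_mk' _ _ _ _ _ _ x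

theorem proj_eq_zero_iff (x : ZReg X.E) :
    X.proj x = 0 ↔ x ∈ AddSubgroup.closure X.relations := by
  rw [← mem_relIdeal, TwoSidedIdeal.mem_iff]
  exact X.relIdeal.ringCon.eq

theorem proj_surjective : Function.Surjective X.proj := Quotient.mk_surjective

/-! ### Exactness at `ℤ[E(E, 𝓡)ˣ]` -/

/-- Pointwise, the cover `R(S, Q)` exhausts `e(S)`: a point of `e(S)` lies either below some `f ∈
Q`, hence in `f e(S)`, or below none, hence in `e(S ∪ {Q})`. So `e(S)` equals the join of the cover
once both are computed in `ℤ[Eˣ]`. -/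
theorem inclNext_relation {z : ZReg X.Next} (hz : z ∈ X.nextRelations) : X.inclNext z = 0 := by
  classical
  obtain ⟨x, hx, T, hT, rfl⟩ := hz
  have hcov := next_isFiniteCover x hx T hT
  refine eq_zero_of_ev fun p hp => ?_
  have h1 : ev p hp (X.inclNext (join T)) = if ∃ t ∈ T, ev p hp t.1 = 1 then 1 else 0 := by
    convert! hom_join ((ev p hp).comp X.inclNext) (fun t : X.Next => ev p hp t.1 = 1) (fun t => by
      rw [NonUnitalRingHom.comp_apply, inclNext_of]
      rcases ev_next t p hp with h | h <;> simp [h]) T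
  have h2 : ev p hp (X.inclNext (of x)) = if ev p hp x.1 = 1 then 1 else 0 := by
    rw [inclNext_of]
    rcases ev_next x p hp with h | h <;> simp [h]
  rw [map_sub, map_sub, h1, h2, sub_eq_zero]
  refine if_congr ⟨fun h => ?_, ?_⟩ rfl rfl
  · obtain ⟨e, S, Q, he, hSn, hS, hQ, hQS, hxe, hTe⟩ := hT
    have hb := (ev_eS_iff he hS hp).1 (hxe ▸ h)
    have hmem : ∀ z ∈ nextCover e S Q, ∃ t ∈ T, t.1 = z := by
      intro z hz
      rw [← hTe] at hz
      exact hz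
    by_cases hpQ : ∃ f ∈ Q, p ≤ f
    · obtain ⟨f, hf, hpf⟩ := hpQ
      have h3 : ev p hp (of f * eS e S) = 1 := (ev_of_mul_iff he hS hp).2 ⟨hpf, hb⟩
      obtain ⟨t, ht, htv⟩ := hmem _ (Or.inr ⟨f, hf, rfl, fun h0 => by simp [h0] at h3⟩)
      exact ⟨t, ht, htv ▸ h3⟩
    · push Not at hpQ
      obtain ⟨t, ht, htv⟩ := hmem (eS e (insert Q S)) (Or.inl (by rw [Set.mem_singleton_iff]))
      exact ⟨t, ht, htv ▸ (ev_eS_iff he (mem_insert_cov hS hQ) hp).2 (below_insert.2 ⟨hb, hpQ⟩)⟩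
  · rintro ⟨t, ht, h⟩
    exact le_iff_ev.1 (hcov.1 t ht).2 p hp h

theorem inclNext_of_mem_closure {z : ZReg X.Next} (hz : z ∈ AddSubgroup.closure X.nextRelations) :
    X.inclNext z = 0 := by
  induction hz using AddSubgroup.closure_induction with
  | zero => exact map_zero X.incl
  | add x y _ _ hx hy => exact (map_add X.inclNext x y).trans (by rw [hx, hy, add_zero])
  | neg x _ hx => exact (map_neg X.inclNext x).trans (by rw [hx, neg_zero])
  | mem x hx => exact inclNext_relation hx

/-! ### Reduction to one selected cover per element, modulo the relations. -/

/-- Modulo the relations of `E(E, 𝓡)`, the difference `e(S) - e(S ∪ {Q})` is a combination of the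
elements `q e(S)`, where `q` is a product of elements of `Q`. -/
theorem of_sub_of_mem {e : X.E} {S : Finset (Finset X.E)} {Q : Finset X.E} (he : e ≠ ⊥)
    (hSn : S.Nonempty) (hS : ∀ R ∈ S, R ∈ X.cov e) (hQ : Q ∈ X.cov e) {Q' : Finset (Finset X.E)}
    (hQ' : ∀ R, R ∈ Q' ↔ R = Q ∨ R ∈ S) {x c : X.Next} (hx : x.1 = eS e S) (hc : c.1 = eS e Q')
    {M : AddSubgroup (ZReg X.Next)} (hM : X.nextRelations ⊆ (M : Set (ZReg X.Next)))
    (hind : ∀ (J : Finset X.E) (hJ : J.Nonempty), J ⊆ Q →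
      ∀ b : X.Next, b.1 = of (J.inf' hJ id) * eS e S → of b ∈ M) :
    of x - of c ∈ M := by
  classical
  -- The set `S ∪ {Q}` enters through its membership relation, so that the lemma does not depend on
  -- the decidability instance behind `insert`.
  obtain rfl : Q' = insert Q S := by ext R; simp [hQ']
  by_cases hQS : Q ∈ S
  · rw [Finset.insert_eq_of_mem hQS, ← hx] at hc
    rw [Next.ext hc, sub_self]
    exact zero_mem M
  have hQS' := mem_insert_cov hS hQ
  -- Multiplication by `e(S)` is a semigroup homomorphism because `e(S)` is idempotent; `Ψ` is its
  -- extension to the semigroup rings.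
  let ψ : X.E → X.Next := fun q => ⟨of q * eS e S, of_mul_eS_mem X.isFiniteCover X.condI he hSn hS⟩
  have hψ0 : ψ ⊥ = ⊥ := Next.ext (by simp [ψ, of_bot, val_bot])
  have hψm : ∀ a b, ψ (a ⊓ b) = ψ a ⊓ ψ b := by
    intro a b
    refine Next.ext ?_
    have hx2 : eS e S * eS e S = eS e S := by
      rw [← hx]; exact mul_self_of_mem X.isFiniteCover x.2
    change of (a ⊓ b) * eS e S = of a * eS e S * (of b * eS e S)
    rw [← of_mul_of, mul_mul_mul_comm, hx2]
  let Ψ : ZReg X.E →ₙ+* ZReg X.Next := lift (fun q => of (ψ q)) (by rw [hψ0, of_bot])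
    (fun a b => by rw [hψm, of_mul_of])
  have hΨ : ∀ q, Ψ (of q) = of (ψ q) := fun q => lift_of _ _ _ q
  -- This is the cover `R(S, Q)` as a finite set in the next semilattice; the zero products `f e(S)`
  -- have to be discarded.
  let T : Finset X.Next := insert c ((Q.image ψ).filter (fun t => t ≠ ⊥))
  have hT : ∀ t, t ∈ T ↔ t = c ∨ (∃ f ∈ Q, ψ f = t) ∧ t ≠ ⊥ := fun t => by
    simp only [T, Finset.mem_insert, Finset.mem_filter, Finset.mem_image]
  have hTe : Next.val '' (T : Set X.Next) = nextCover e S Q := by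
    ext z
    constructor
    · rintro ⟨t, ht, rfl⟩
      rcases (hT t).1 ht with rfl | ⟨⟨f, hf, rfl⟩, hne⟩
      · left; rw [Set.mem_singleton_iff, hc]
      · exact Or.inr ⟨f, hf, rfl, ne_bot_iff.1 hne⟩
    · rintro (h | ⟨f, hf, rfl, h0⟩)
      · have h : z = eS e (insert Q S) := by convert! Set.mem_singleton_iff.1 h
        exact ⟨c, (hT c).2 (Or.inl rfl), hc.trans h.symm⟩
      · exact ⟨ψ f, (hT _).2 (Or.inr ⟨⟨f, hf, rfl⟩, ne_bot_iff.2 h0⟩), rfl⟩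
  have hdisj : ∀ f ∈ Q, c ⊓ ψ f = ⊥ := by
    intro f hf
    by_contra hne
    obtain ⟨p, hp, h⟩ := exists_ev_of_ne hne
    have h1 := le_iff_ev.1 (inf_le_left : c ⊓ ψ f ≤ c) p hp h
    have h2 := le_iff_ev.1 (inf_le_right : c ⊓ ψ f ≤ ψ f) p hp h
    rw [hc] at h1
    exact (below_insert.1 ((ev_eS_iff he hQS' hp).1 h1)).2 f hf ((ev_of_mul_iff he hS hp).1 h2).1
  -- The element `c` is disjoint from all `f e(S)`, so its contribution to the join is additive,
  -- while the join of the `f e(S)` is the image under `Ψ` of `⋁ Q`.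
  have hjoin : join T = of c + Ψ (join Q) := by
    refine ext_ev fun P hP => ?_
    have h2 : ev P hP (Ψ (join Q)) = if ∃ f ∈ Q, P ≤ ψ f then 1 else 0 :=
      hom_join ((ev P hP).comp Ψ) (fun q => P ≤ ψ q) (fun q => by
        rw [NonUnitalRingHom.comp_apply, hΨ, ev_of]) Q
    rw [map_add, h2, ev_join, ev_of]
    have hiff : (∃ t ∈ T, P ≤ t) ↔ (P ≤ c ∨ ∃ f ∈ Q, P ≤ ψ f) := by
      constructor
      · rintro ⟨t, ht, hPt⟩
        rcases (hT t).1 ht with rfl | ⟨⟨f, hf, rfl⟩, -⟩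
        · exact Or.inl hPt
        · exact Or.inr ⟨f, hf, hPt⟩
      · rintro (h | ⟨f, hf, h⟩)
        · exact ⟨c, (hT c).2 (Or.inl rfl), h⟩
        · exact ⟨ψ f, (hT _).2 (Or.inr ⟨⟨f, hf, rfl⟩, ne_bot_of_le_ne_bot hP h⟩), h⟩
    by_cases h3 : P ≤ c
    · have h4 : ¬ ∃ f ∈ Q, P ≤ ψ f := by
        rintro ⟨f, hf, h⟩
        exact hP (le_bot_iff.1 (hdisj f hf ▸ le_inf h3 h))
      rw [if_pos (hiff.2 (Or.inl h3)), if_pos h3, if_neg h4, add_zero]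
    · rw [if_neg h3, zero_add]
      exact if_congr (hiff.trans (or_iff_right h3)) rfl rfl
  have hx0 : x ≠ ⊥ := ne_bot_iff.2 (hx ▸ eS_ne_zero X.isFiniteCover X.condII he hS)
  have hrel : of x - join T ∈ M :=
    hM ⟨x, hx0, T, ⟨e, S, Q, he, hSn, hS, hQ, hQS, hx, hTe⟩, rfl⟩
  -- Expanding `⋁ Q` gives an integral combination of the elements `q e(S)`, with `q` a product over
  -- a nonempty subset of `Q`; these lie in `M` by `hind`.
  have hΨM : Ψ (join Q) ∈ M := by
    rw [join, map_sum]
    refine sum_mem fun J hJ => ?_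
    split_ifs with h
    · rw [map_zsmul, hΨ]
      exact zsmul_mem (hind J h (Finset.mem_powerset.1 hJ) _ rfl) _
    · rw [map_zero]; exact zero_mem M
  have : of x - of c = (of x - join T) + Ψ (join Q) := by rw [hjoin]; abel
  rw [this]
  exact add_mem hrel hΨM

/-- The element `a` of `E(E, 𝓡)` is of the form `e(S)` where `e` and all the elements of the covers
in `S` belong to `F`. -/
def IsSupportedAt (F : Set X.E) (e : X.E) (a : X.Next) : Prop :=
  e ≠ ⊥ ∧ e ∈ F ∧ ∃ S : Finset (Finset X.E), S.Nonempty ∧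
    (∀ R ∈ S, R ∈ X.cov e ∧ (R : Set X.E) ⊆ F) ∧ a.1 = eS e S

theorem IsSupportedAt.mono {F G : Set X.E} (h : F ⊆ G) {e : X.E} {a : X.Next}
    (ha : IsSupportedAt F e a) : IsSupportedAt G e a := by
  obtain ⟨he, heF, S, hSn, hS, hae⟩ := ha
  exact ⟨he, h heF, S, hSn, fun R hR => ⟨(hS R hR).1, (hS R hR).2.trans h⟩, hae⟩

/-- Independence applied to the single cover `R` shows that `e` itself is a point of `e({R})`. This
makes products of elements of a cover strictly smaller than `e`, which drives the induction below.
-/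
theorem not_le_of_mem_cov {e : X.E} (he : e ≠ ⊥) {R : Finset X.E} (hR : R ∈ X.cov e) {f : X.E}
    (hf : f ∈ R) : ¬ e ≤ f :=
  (below_self X.isFiniteCover X.condII he (T := {R}) (by simpa using hR)).2 R (by simp) f hf

/-- If `c` selects a cover in a finite subsemilattice `F`, then the elements `e({c e})` generate,
modulo the relations of `E(E, 𝓡)`, all the elements `e(S)` that are supported in `F`. -/
theorem of_mem_of_isSupportedAt {F : Set X.E} (hF : InfClosed F) (hFf : F.Finite)
    {c : X.E → Finset X.E} (hc : ∀ e, (∃ R ∈ X.cov e, (R : Set X.E) ⊆ F) →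
      c e ∈ X.cov e ∧ (c e : Set X.E) ⊆ F)
    {M : AddSubgroup (ZReg X.Next)} (hM : X.nextRelations ⊆ (M : Set (ZReg X.Next)))
    (hcM : ∀ (e : X.E) (a : X.Next), e ≠ ⊥ → c e ∈ X.cov e → a.1 = eS e {c e} → of a ∈ M)
    {e : X.E} {a : X.Next} (ha : IsSupportedAt F e a) : of a ∈ M := by
  classical
  -- The induction descends along the strict order of the finite set `F`, simultaneously for all
  -- `e(S)` with the same `e`.
  have hwf : F.WellFoundedOn (· < ·) := hFf.wellFoundedOn
  have main : ∀ e ∈ F, ∀ a : X.Next, IsSupportedAt F e a → of a ∈ M := by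
    intro e heF
    refine hwf.induction (P := fun e => ∀ a : X.Next, IsSupportedAt F e a → of a ∈ M) heF ?_
    intro e heF ih a ha
    obtain ⟨he, -, S, hSn, hS, hae⟩ := ha
    -- Adjoining one cover `Q` to `S'` does not change the class modulo `M`: the correction terms `q
    -- e(S')` are supported at some `q < e`.
    have step : ∀ (S' : Finset (Finset X.E)) (Q : Finset X.E) (x y : X.Next), S'.Nonempty →
        (∀ R ∈ S', R ∈ X.cov e ∧ (R : Set X.E) ⊆ F) → Q ∈ X.cov e → (Q : Set X.E) ⊆ F →
        x.1 = eS e S' → y.1 = eS e (insert Q S') → of x - of y ∈ M := by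
      intro S' Q x y hSn' hS' hQ hQF hx hy
      refine of_sub_of_mem he hSn' (fun R hR => (hS' R hR).1) hQ (by simp) hx hy hM ?_
      intro J hJ hJQ b hb
      by_cases hb0 : b = ⊥
      · rw [hb0, of_bot]; exact zero_mem M
      have hb0' := ne_bot_iff.1 hb0
      rw [hb] at hb0'
      set q := J.inf' hJ id with hq
      have hqF : q ∈ F := hF.finsetInf'_mem hJ fun f hf => hQF (hJQ hf)
      obtain ⟨f, hf⟩ := hJ
      have hqf : q ≤ f := Finset.inf'_le id hf
      have hqe : q ≤ e := hqf.trans ((X.isFiniteCover e he Q hQ).1 f (hJQ hf)).2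
      have hlt : q < e := lt_of_le_not_ge hqe fun h =>
        not_le_of_mem_cov he hQ (hJQ hf) (h.trans hqf)
      have hq0 : q ≠ ⊥ := fun h => hb0' (by rw [h, of_bot, zero_mul])
      have hqe' : q ⊓ e = q := inf_eq_left.2 hqe
      -- By (i), the nonzero product `q e(S')` is `q(W)`, where `W` consists of the covers cut down
      -- by `q`. Their elements are products of two elements of `F`, hence stay in `F`.
      rcases of_mul_eS X.isFiniteCover X.condI (d := q) (e := e) (by rwa [hqe'])
        (fun R hR => (hS' R hR).1) with h | ⟨W, hW, hWm, h⟩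
      · exact absurd h hb0'
      rw [hqe'] at hWm h
      refine ih q hqF hlt b ⟨hq0, hqF, W, ?_, fun R' hR' => ⟨hWm R' hR', ?_⟩, hb.trans h⟩
      · obtain ⟨R, hR⟩ := hSn'
        exact ⟨_, (hW _).2 ⟨R, hR, rfl⟩⟩
      · obtain ⟨R, hR, rfl⟩ := (hW R').1 hR'
        intro g hg
        obtain ⟨f, hf, rfl, -⟩ := mem_cut.1 hg
        exact hF hqF ((hS' R hR).2 hf)
    obtain ⟨R₀, hR₀⟩ := hSn
    obtain ⟨hce, hcF⟩ := hc e ⟨R₀, hS R₀ hR₀⟩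
    have hmem : ∀ S' : Finset (Finset X.E), S'.Nonempty →
        (∀ R ∈ S', R ∈ X.cov e ∧ (R : Set X.E) ⊆ F) → eS e S' ∈ nextSet X.cov :=
      fun S' hn h => Or.inl ⟨e, S', he, hn, fun R hR => (h R hR).1, rfl⟩
    have hins : ∀ S' ⊆ S, ∀ R ∈ insert (c e) S', R ∈ X.cov e ∧ (R : Set X.E) ⊆ F := by
      intro S' hS' R hR
      rcases Finset.mem_insert.1 hR with rfl | hR
      · exact ⟨hce, hcF⟩
      · exact hS R (hS' hR)
    -- Starting from `e({c e})`, which lies in `M` by assumption, the covers of `S` are adjoined one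
    -- at a time.
    have hgrow : ∀ S' ⊆ S, ∀ y : X.Next, y.1 = eS e (insert (c e) S') → of y ∈ M := by
      intro S'
      induction S' using Finset.induction_on with
      | empty => exact fun _ y hy => hcM e y he hce (by rw [hy]; rfl)
      | insert Q S' _ ihS =>
        intro hsub y hy
        have hS' : S' ⊆ S := (Finset.subset_insert _ _).trans hsub
        have hQ := hS Q (hsub (Finset.mem_insert_self _ _))
        have h1 := ihS hS' ⟨_, hmem _ (Finset.insert_nonempty _ _) (hins S' hS')⟩ rfl
        have h2 := step _ Q ⟨_, hmem _ (Finset.insert_nonempty _ _) (hins S' hS')⟩ y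
          (Finset.insert_nonempty _ _) (hins S' hS') hQ.1 hQ.2 rfl
          (by rw [hy, Finset.insert_comm])
        have h3 := sub_mem h1 h2
        rwa [sub_sub_cancel] at h3
    -- Two paths meet at `e(S ∪ {c e})`: it is reached from `e({c e})` by adjoining `S`, and from
    -- `e(S)` by adjoining `c e`.
    have hy := hgrow S subset_rfl ⟨_, hmem _ (Finset.insert_nonempty _ _) (hins S subset_rfl)⟩ rfl
    have h1 := step S (c e) a ⟨_, hmem _ (Finset.insert_nonempty _ _) (hins S subset_rfl)⟩
      ⟨R₀, hR₀⟩ hS hce hcF hae rfl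
    have := add_mem h1 hy
    rwa [sub_add_cancel] at this
  exact main e ha.2.1 a ha

/-! ### Independence of the selected elements, and the kernel. -/

/-- The elements `e({c e})`, where `c e` is a cover for `e`, are linearly independent in `ℤ[Eˣ]`. -/
theorem eq_zero_of_inclNext_eq_zero {c : X.E → Finset X.E} {y : ZReg X.Next}
    (hy : ∀ a ∈ supp y, ∃ e, e ≠ ⊥ ∧ c e ∈ X.cov e ∧ a.1 = eS e {c e}) (h0 : X.inclNext y = 0) :
    y = 0 := by
  classical
  by_contra hne
  choose! t ht0 htc hta using hy
  -- Choose a term of `y` whose top element `t a` is maximal and evaluate at `t a`; only this term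
  -- will contribute, so its coefficient vanishes.
  obtain ⟨a, ha, hmax⟩ := (supp_finite y).exists_maximalFor t _ (supp_nonempty hne)
  have hcov : ∀ b ∈ supp y, ∀ R ∈ ({c (t b)} : Finset (Finset X.E)), R ∈ X.cov (t b) :=
    fun b hb => by simpa using htc b hb
  obtain ⟨ha0, han⟩ := id ha
  have hsum : X.inclNext y = ∑ b ∈ (toFinsupp y).support, toFinsupp y b • b.1.1 := by
    conv_lhs => rw [eq_sum y, map_sum]
    exact Finset.sum_congr rfl fun b _ => by rw [map_zsmul, inclNext_of]
  have hev := congrArg (ev (t a) (ht0 a ha)) hsum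
  rw [h0, map_zero, map_sum, Finset.sum_eq_single ⟨a, ha0⟩] at hev
  · rw [map_zsmul, hta a ha, (ev_eS_iff (ht0 a ha) (hcov a ha) _).2
      (below_self X.isFiniteCover X.condII (ht0 a ha) (hcov a ha)), smul_eq_mul, mul_one] at hev
    exact han hev.symm
  -- A term `b` that does not vanish at `t a` satisfies `t a ≤ t b`, hence `t b = t a` by
  -- maximality. Since the cover is determined by the top element, `b = a`.
  · rintro ⟨b, hb0⟩ hb hba
    have hb' : b ∈ supp y := ⟨hb0, by simpa using hb⟩
    rw [map_zsmul]
    rcases ev_next b (t a) (ht0 a ha) with h | h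
    · rw [h, smul_zero]
    · exfalso
      rw [hta b hb'] at h
      have hle : t a ≤ t b := ((ev_eS_iff (ht0 b hb') (hcov b hb') _).1 h).1
      have heq : t b = t a := le_antisymm (hmax hb' hle) hle
      refine hba (Subtype.ext (Next.ext ?_))
      change b.1 = a.1
      rw [hta b hb', hta a ha, heq]
  · intro h
    exact absurd (by simpa using h) han

/-- This confines `x` to finitely many elements of `E`. Quantifying over all subgroups `M` allows
the later choice of `M`, which itself depends on the finite set. -/
theorem exists_finite_support (x : ZReg X.Next) : ∃ G : Set X.E, G.Finite ∧
    ∀ M : AddSubgroup (ZReg X.Next), (∀ e a, IsSupportedAt G e a → of a ∈ M) → x ∈ M := by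
  induction x using ZReg.induction with
  | hof a =>
    by_cases ha : a = ⊥
    · exact ⟨∅, Set.finite_empty, fun M _ => by rw [ha, of_bot]; exact zero_mem M⟩
    obtain ⟨e, S, he, hSn, hS, hae⟩ := exists_rep ha
    refine ⟨{e} ∪ ⋃ R ∈ S, (R : Set X.E), (Set.finite_singleton e).union
      (S.finite_toSet.biUnion fun R _ => R.finite_toSet), fun M hM => hM e a
        ⟨he, Or.inl rfl, S, hSn, fun R hR => ⟨hS R hR, fun f hf => Or.inr ?_⟩, hae⟩⟩
    exact Set.mem_biUnion (t := fun R : Finset X.E => (R : Set X.E)) (Finset.mem_coe.2 hR) hf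
  | hadd x y hx hy =>
    obtain ⟨G, hG, hx⟩ := hx
    obtain ⟨H, hH, hy⟩ := hy
    exact ⟨G ∪ H, hG.union hH, fun M hM => add_mem
      (hx M fun e a ha => hM e a (ha.mono Set.subset_union_left))
      (hy M fun e a ha => hM e a (ha.mono Set.subset_union_right))⟩
  | hneg x hx =>
    obtain ⟨G, hG, hx⟩ := hx
    exact ⟨G, hG, fun M hM => neg_mem (hx M hM)⟩

theorem inclNext_eq_zero_iff (x : ZReg X.Next) :
    X.inclNext x = 0 ↔ x ∈ AddSubgroup.closure X.nextRelations := by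
  classical
  refine ⟨fun h => ?_, inclNext_of_mem_closure⟩
  obtain ⟨G, hG, hx⟩ := exists_finite_support x
  -- Closing under products keeps the set finite and makes it stable under the cutting of covers.
  let F := infClosure G
  -- The default `∅` is never selected for a nonzero `e`, since it is not a cover for such an `e`;
  -- `B` moreover requires `c e ∈ X.cov e`.
  let c : X.E → Finset X.E := fun e =>
    if h : ∃ R ∈ X.cov e, (R : Set X.E) ⊆ F then h.choose else ∅
  have hc : ∀ e, (∃ R ∈ X.cov e, (R : Set X.E) ⊆ F) → c e ∈ X.cov e ∧ (c e : Set X.E) ⊆ F := by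
    intro e he
    simp only [c, dif_pos he]
    exact he.choose_spec
  let N : AddSubgroup (ZReg X.Next) := AddSubgroup.closure X.nextRelations
  let B : Set (ZReg X.Next) :=
    {z | ∃ (e : X.E) (a : X.Next), e ≠ ⊥ ∧ c e ∈ X.cov e ∧ a.1 = eS e {c e} ∧ z = of a}
  have hxM : x ∈ N ⊔ AddSubgroup.closure B := by
    refine hx _ fun e a ha => of_mem_of_isSupportedAt infClosed_infClosure hG.infClosure hc
      (AddSubgroup.subset_closure.trans (le_sup_left (a := N))) (fun e a he hce hae => ?_)
      (ha.mono subset_infClosure)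
    exact (le_sup_right (a := N)) (AddSubgroup.subset_closure ⟨e, a, he, hce, hae, rfl⟩)
  -- The element splits into a combination `r` of relations and a combination `y` of selected
  -- elements. As `r` maps to zero, so does `y`, and independence gives `y = 0`.
  obtain ⟨r, hr, y, hy, rfl⟩ := AddSubgroup.mem_sup.1 hxM
  have hy0 : X.inclNext y = 0 := by
    rwa [map_add, inclNext_of_mem_closure hr, zero_add] at h
  have hyB : ∀ a ∈ supp y, ∃ e, e ≠ ⊥ ∧ c e ∈ X.cov e ∧ a.1 = eS e {c e} := by
    clear hxM hy0 h hx
    induction hy using AddSubgroup.closure_induction with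
    | zero => intro a ha; simp [supp_zero] at ha
    | add y z _ _ hy hz => exact fun a ha => (supp_add ha).elim (hy a) (hz a)
    | neg y _ hy => exact fun a ha => hy a (supp_zsmul (n := -1) (by rwa [neg_one_smul]))
    | mem z hz =>
      obtain ⟨e, b, he, hce, hb, rfl⟩ := hz
      intro a ha
      rw [supp_of ha]
      exact ⟨e, he, hce, hb⟩
  rw [eq_zero_of_inclNext_eq_zero hyB hy0, add_zero]
  exact hr

/-! ### Equivariance -/

theorem inclNext_nextAct (g : Γ) (x : ZReg X.Next) :
    X.inclNext (autMap (X.nextAct g) x) = X.act g (X.inclNext x) := by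
  induction x using ZReg.induction with
  | hof a => rw [autMap_of, inclNext_of, inclNext_of, val_nextAct]
  | hadd x y hx hy => simp only [map_add, hx, hy]
  | hneg x hx => simp only [map_neg, hx]

/-- The ideal is invariant because it is the image of an equivariant map. -/
theorem act_mem_closure (g : Γ) {x : ZReg X.E} (hx : x ∈ AddSubgroup.closure X.relations) :
    X.act g x ∈ AddSubgroup.closure X.relations := by
  rw [← mem_range_inclNext] at hx ⊢
  obtain ⟨y, rfl⟩ := hx
  exact ⟨autMap (X.nextAct g) y, inclNext_nextAct g y⟩

theorem proj_eq_iff (x y : ZReg X.E) :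
    X.proj x = X.proj y ↔ x - y ∈ AddSubgroup.closure X.relations := by
  rw [← proj_eq_zero_iff, map_sub, sub_eq_zero]

theorem proj_act_eq (g : Γ) {x y : ZReg X.E} (h : X.proj x = X.proj y) :
    X.proj (X.act g x) = X.proj (X.act g y) := by
  rw [proj_eq_iff] at h ⊢
  rw [← map_sub]
  exact act_mem_closure g h

variable (X)

/-- The map that an element of `Γ` induces on `ℤ[Eˣ] / I`. -/
noncomputable def quotAct (g : Γ) : X.Quot → X.Quot :=
  Quotient.lift (fun x => X.proj (X.act g x))
    (fun _ _ h => proj_act_eq g (Quotient.sound h))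

variable {X}

theorem quotAct_proj (g : Γ) (x : ZReg X.E) : X.quotAct g (X.proj x) = X.proj (X.act g x) := rfl

variable (X)

/-- The action of `Γ` on `ℤ[Eˣ] / I`. -/
noncomputable def quotActHom : Γ →* RingAut X.Quot where
  toFun g :=
    { toFun := X.quotAct g
      invFun := X.quotAct g⁻¹
      left_inv := proj_surjective.forall.2 fun x => by
        rw [quotAct_proj, quotAct_proj, act_inv_act]
      right_inv := proj_surjective.forall.2 fun x => by
        rw [quotAct_proj, quotAct_proj, act_act_inv]
      map_mul' := proj_surjective.forall₂.2 fun x y => by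
        simp only [← map_mul, quotAct_proj]
      map_add' := proj_surjective.forall₂.2 fun x y => by
        simp only [← map_add, quotAct_proj] }
  map_one' := RingEquiv.ext <| proj_surjective.forall.2 fun x =>
    congrArg (fun f : RingAut (ZReg X.E) => X.proj (f x)) (map_one X.act)
  map_mul' g h := RingEquiv.ext <| proj_surjective.forall.2 fun x =>
    congrArg (fun f : RingAut (ZReg X.E) => X.proj (f x)) (map_mul X.act g h)

end CoverSystem
end IndRes

/-! ### The equivariant long exact sequence. -/

theorem theorem4 {Γ : Type v} [Group Γ] (X : IndRes.CoverSystem.{u, v} Γ) :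
    -- exactness of `⋯ → ℤ[E₂ˣ] → ℤ[E₁ˣ] → ℤ[Eˣ] → ℤ[Eˣ] / I → 0`
    (∀ k : ℕ, Function.Exact (X.boundary (k + 1)) (X.boundary k)) ∧
    Function.Exact (X.boundary 0) X.proj ∧
    Function.Surjective X.proj ∧
    -- `Γ`-equivariance, for the induced actions on `ℤ[E_kˣ]` and on `ℤ[Eˣ] / I`
    (∀ (k : ℕ) (g : Γ) (x : IndRes.ZReg (X.iter (k + 1)).E),
      X.boundary k ((X.iter (k + 1)).act g x) = (X.iter k).act g (X.boundary k x)) ∧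
    (∃ σ : Γ →* RingAut X.Quot, ∀ (g : Γ) (x : IndRes.ZReg X.E),
      X.proj (X.act g x) = σ g (X.proj x)) := by
  refine ⟨fun k x => ?_, fun x => ?_, IndRes.CoverSystem.proj_surjective,
    fun k g x => IndRes.CoverSystem.inclNext_nextAct (X := X.iter k) g x, X.quotActHom, fun g x => rfl⟩
  -- By definition, the relations in the kernel statement at level `k` are the relations of level `k
  -- + 1`, whose span is the image of the preceding map.
  · exact (IndRes.CoverSystem.inclNext_eq_zero_iff (X := X.iter k) x).trans
      (IndRes.CoverSystem.mem_range_inclNext (X := (X.iter k).next) x).symm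
  · exact (IndRes.CoverSystem.proj_eq_zero_iff x).trans
      (IndRes.CoverSystem.mem_range_inclNext x).symm
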